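/- **Setting.** Let $T>0$, let $S$ be a finite non-empty set of regimes, and let $R$ be a probability measure on the space of càdlàg paths $[0,T]\to\mathbb R^d\times S$, with canonical process $(X_t,\Lambda_t)$ and marginals $R_t$ (for instance the law of a regime-switching jump diffusion). Suppose $R$ has a transition density: for $0\le t<s\le T$ and $i,j\in S$ there is a measurable, bounded, non-negative function $(x,y)\mapsto p_{ij}(t,x,s,y)$ with $\sum_j\int p_{ij}(t,x,s,y)\,dy=1$ for all $(x,i)$ and $$R\big(X_s\in B,\Lambda_s=j\mid (X_t,\Lambda_t)=(x,i)\big)=\int_B p_{ij}(t,x,s,y)\,dy$$ for all Borel $B$, for $R_t$-a.e. $(x,i)$. Suppose $R_0$ has Lebesgue densities in each regime. Let $\rho_0,\rho_T$ be probability measures on $\mathbb R^d\times S$ with $\rho_0\ll R_0$ and with densities $\rho_0(\cdot,i),\rho_T(\cdot,j)$ that have compact supports $A_0^i,A_T^j$ (closures of the sets where the densities are non-zero), and suppose that $p_{ij}(0,\cdot,T,\cdot)$ is continuous and positive on $A_0^i\times A_T^j$ for all $i,j\in S$. Write $\mathcal D(f)=1/f$, $$\mathcal E_{\rho_T}(f)(x,i)=\sum_{j}\int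 p_{ij}(0,x,T,y)\rho_T(y,j)f(y,j)\,dy,\qquad \mathcal E_{\rho_0}(f)(y,j)=\sum_{i}\int p_{ij}(0,x,T,y)\rho_0(x,i)f(x,i)\,dx,$$ $\mathcal C=\mathcal E_{\rho_0}\circ\mathcal D\circ\mathcal E_{\rho_T}\circ\mathcal D$, and $\|f\|^2=\sum_j\|f(\cdot,j)\|^2_{L^2(A_T^j)}$. (Quotients with denominator zero occur only where they are multiplied by a vanishing density or have numerator zero; the product, respectively quotient, is then read as $0$.) Call $f:\mathbb R^d\times S\to[0,\infty)$ *admissible* if it is measurable and bounded and $\inf_{A_T^j}f(\cdot,j)>0$ for every $j$. **Theorem.** 1. There is an admissible $f_\infty$ with $\mathcal C(f_\infty)=f_\infty$ and $\|f_\infty\|=1$. It is unique: if $g$ is measurable, $g>0$ and $\mathcal C(g)=g$ a.e. on the sets $A_T^j$, and $\|g\|=1$, then $g=f_\infty$ a.e. on the sets $A_T^j$; and $g=f_\infty$ everywhere if $\mathcal C(g)=g$ everywhere. 2. For every admissible $f_0$ all iterates $\mathcal C^k(f_0)$ are admissible with $0<\|\mathcal C^k(f_0)\|<\infty$, and $f_k:=\mathcal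 C^k(f_0)/\|\mathcal C^k(f_0)\|\to f_\infty$ as $k\to\infty$, both in $\|\cdot\|$ and in Hilbert's projective metric $\log\big(\sup(f/g)/\inf(f/g)\big)$, where the supremum and the infimum are taken over $\{(y,j):y\in A_T^j\}$. 3. The quadruple $$\widehat\varphi(T,\cdot)=f_\infty,\quad \varphi(T,\cdot)=\rho_T/f_\infty,\quad \varphi(0,\cdot)=\mathcal E_{\rho_T}\circ\mathcal D(f_\infty),\quad \widehat\varphi(0,\cdot)=\rho_0/\varphi(0,\cdot)$$ is a non-negative measurable solution, with convergent integrals, of the Schrödinger system $$\varphi(0,x,i)=\sum_j\int p_{ij}(0,x,T,y)\varphi(T,y,j)\,dy,\qquad \widehat\varphi(T,y,j)=\sum_i\int p_{ij}(0,x,T,y)\widehat\varphi(0,x,i)\,dx,$$ $$\rho_0(x,i)=\varphi(0,x,i)\widehat\varphi(0,x,i),\qquad \rho_T(y,j)=\varphi(T,y,j)\widehat\varphi(T,y,j)$$ (the first equation for $R_0$-a.e. $(x,i)$, the other three Lebesgue-a.e. in each regime). It is unique up to rescaling: for every non-negative measurable solution $(\varphi',\widehat\varphi')$ with convergent integrals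 there is $c>0$ such that $\varphi'(0,\cdot)=c^{-1}\varphi(0,\cdot)$ and $\widehat\varphi'(0,\cdot)=c\,\widehat\varphi(0,\cdot)$ $\rho_0$-a.e., and $\varphi'(T,\cdot)=c^{-1}\varphi(T,\cdot)$ and $\widehat\varphi'(T,\cdot)=c\,\widehat\varphi(T,\cdot)$ $\rho_T$-a.e. If moreover, for all $i,j$, $\widehat\varphi'(0,\cdot,i)=0$ a.e. outside $A_0^i$ and $\varphi'(T,\cdot,j)=0$ a.e. outside $A_T^j$, then, with the same $c$, the identity for $\varphi'(0,\cdot)$ holds $R_0$-a.e. and the other three hold Lebesgue-a.e. -/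

import Mathlib

open MeasureTheory ProbabilityTheory Filter Topology
open scoped ENNReal

noncomputable section

namespace RegimeSchrodinger

/-- The spatial component `ℝ^d` of the state space. -/
abbrev Space (d : ℕ) := EuclideanSpace ℝ (Fin d)

/-- The hybrid state space `ℝ^d × S`, where `S = Fin m` is the finite set of regimes (discrete
topology, full σ-algebra). -/
abbrev State (d m : ℕ) := Space d × Fin m

/-- Càdlàg functions `[0,T] → ℝ^d × S`. The σ-algebra is the one inherited from the product
σ-algebra, that is, the one generated by the time projections. -/
abbrev CadlagPath (d m : ℕ) (T : ℝ) :=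
  {ω : Set.Icc (0 : ℝ) T → State d m //
    (∀ t, ContinuousWithinAt ω (Set.Ici t) t) ∧ ∀ t, ∃ l, Tendsto ω (𝓝[<] t) (𝓝 l)}

/-- The canonical process `(X_t, Λ_t)` on the path space. -/
def canonical {d m : ℕ} {T : ℝ} (t : Set.Icc (0 : ℝ) T) (ω : CadlagPath d m T) : State d m :=
  ω.1 t

/-- The marginal distribution `R_t` of `(X_t, Λ_t)` under the path measure `R`. -/
def marginal {d m : ℕ} {T : ℝ} (R : Measure (CadlagPath d m T)) (t : Set.Icc (0 : ℝ) T) :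
    Measure (State d m) :=
  R.map (canonical t)

/-- `p i j t x s y`, for `t < s`, is a bounded transition density of the path measure `R`:
`R (X_s ∈ B, Λ_s = j | (X_t, Λ_t) = (x, i)) = ∫_B p i j t x s y dy`.
(Conditional laws given the value of `(X_t, Λ_t)` are determined up to `R_t`-null sets.) -/
structure IsTransitionDensity {d m : ℕ} [NeZero m] {T : ℝ} (R : Measure (CadlagPath d m T)) [IsFiniteMeasure R]
    (p : Fin m → Fin m → Set.Icc (0 : ℝ) T → Space d → Set.Icc (0 : ℝ) T → Space d → ℝ) :
    Prop where
  measurable : ∀ i j t s, t < s → Measurable fun z : Space d × Space d => p i j t z.1 s z.2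
  nonneg : ∀ i j t s x y, t < s → 0 ≤ p i j t x s y
  total : ∀ i t s x, t < s → ∑ j, ∫⁻ y, ENNReal.ofReal (p i j t x s y) = 1
  condDistrib_eq : ∀ t s, t < s → ∀ᵐ z ∂(marginal R t), ∀ (B : Set (Space d)) (j : Fin m),
    MeasurableSet B →
      condDistrib (canonical s) (canonical t) R z (B ×ˢ {j})
        = ∫⁻ y in B, ENNReal.ofReal (p z.2 j t z.1 s y)
  bounded : ∀ i j t s, t < s → ∃ M : ℝ, ∀ x y, p i j t x s y ≤ M

/-- The measure `μ` on `ℝ^d × S` has the Lebesgue densities `x ↦ q x i`, `i ∈ S`. -/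
structure HasDensities {d m : ℕ} (μ : Measure (State d m)) (q : Space d → Fin m → ℝ) :
    Prop where
  measurable : ∀ i, Measurable fun x => q x i
  nonneg : ∀ x i, 0 ≤ q x i
  measure_eq : ∀ (i : Fin m) (B : Set (Space d)), MeasurableSet B →
    μ (B ×ˢ {i}) = ∫⁻ x in B, ENNReal.ofReal (q x i)

/-- The supports `A^i`, i.e. the closure of `{x | q x i ≠ 0}`, of a family of densities. -/
def supp {d m : ℕ} (q : Space d → Fin m → ℝ) (i : Fin m) : Set (Space d) :=
  tsupport fun x => q x i

/-- The map `D f = 1 / f`. -/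
def invMap {d m : ℕ} (f : Space d → Fin m → ℝ) : Space d → Fin m → ℝ :=
  fun x i => 1 / f x i

/-- `E_{ρ_T} f (x,i) = ∑ j, ∫ P i j x y ρ_T(y,j) f(y,j) dy`. -/
def backwardMap {d m : ℕ} (P : Fin m → Fin m → Space d → Space d → ℝ)
    (qT : Space d → Fin m → ℝ) (f : Space d → Fin m → ℝ) : Space d → Fin m → ℝ :=
  fun x i => ∑ j, ∫ y, P i j x y * qT y j * f y j

/-- `E_{ρ_0} f (y,j) = ∑ i, ∫ P i j x y ρ_0(x,i) f(x,i) dx`. -/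
def forwardMap {d m : ℕ} (P : Fin m → Fin m → Space d → Space d → ℝ)
    (q₀ : Space d → Fin m → ℝ) (f : Space d → Fin m → ℝ) : Space d → Fin m → ℝ :=
  fun y j => ∑ i, ∫ x, P i j x y * q₀ x i * f x i

/-- One step `C = E_{ρ_0} ∘ D ∘ E_{ρ_T} ∘ D` of the Fortet–Sinkhorn algorithm. -/
def sinkhorn {d m : ℕ} (P : Fin m → Fin m → Space d → Space d → ℝ)
    (q₀ qT : Space d → Fin m → ℝ) (f : Space d → Fin m → ℝ) : Space d → Fin m → ℝ :=
  forwardMap P q₀ (invMap (backwardMap P qT (invMap f)))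

/-- The norm `(∑ j, ‖f(·,j)‖²_{L²(A j)})^{1/2}`, with value in `[0,∞]`. -/
def suppNorm {d m : ℕ} (A : Fin m → Set (Space d)) (f : Space d → Fin m → ℝ) : ℝ≥0∞ :=
  (∑ j, eLpNorm (fun y => f y j) 2 (volume.restrict (A j)) ^ 2) ^ (1 / 2 : ℝ)

/-- The normalization `f / ‖f‖`. -/
def normalize {d m : ℕ} (A : Fin m → Set (Space d)) (f : Space d → Fin m → ℝ) :
    Space d → Fin m → ℝ :=
  fun y j => f y j / (suppNorm A f).toReal

/-- Hilbert's projective metric `log (sup (f/g) / inf (f/g))`, with supremum and infimum over all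
`(y,j)` with `y ∈ A j`. It is used only for admissible `f`, `g`. -/
def hilbertMetric {d m : ℕ} (A : Fin m → Set (Space d)) (f g : Space d → Fin m → ℝ) : ℝ :=
  Real.log ((⨆ z : {z : State d m // z.1 ∈ A z.2}, f z.1.1 z.1.2 / g z.1.1 z.1.2) /
    (⨅ z : {z : State d m // z.1 ∈ A z.2}, f z.1.1 z.1.2 / g z.1.1 z.1.2))

/-- Measurable bounded functions `f : ℝ^d × S → [0,∞)` with `inf_{A j} f(·,j) > 0` for all `j`. -/
structure IsAdmissible {d m : ℕ} (A : Fin m → Set (Space d)) (f : Space d → Fin m → ℝ) :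
    Prop where
  measurable : ∀ j, Measurable fun y => f y j
  nonneg : ∀ y j, 0 ≤ f y j
  bounded : ∃ M : ℝ, ∀ y j, f y j ≤ M
  lower : ∀ j, ∃ c : ℝ, 0 < c ∧ ∀ y ∈ A j, c ≤ f y j

/-- The Schrödinger system with kernel `P`, initial data `R₀` and target densities `q₀`, `qT`, for
non-negative measurable `φ₀ = φ(0,·)`, `ψ₀ = φ̂(0,·)`, `φT = φ(T,·)`, `ψT = φ̂(T,·)`; the
integrals are required to converge. -/
structure IsSchrodingerSolution {d m : ℕ} (R₀ : Measure (State d m))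
    (P : Fin m → Fin m → Space d → Space d → ℝ) (q₀ qT : Space d → Fin m → ℝ)
    (φ₀ ψ₀ φT ψT : Space d → Fin m → ℝ) : Prop where
  measurable : ∀ i, (Measurable fun x => φ₀ x i) ∧ (Measurable fun x => ψ₀ x i) ∧
    (Measurable fun y => φT y i) ∧ (Measurable fun y => ψT y i)
  nonneg : ∀ x i, 0 ≤ φ₀ x i ∧ 0 ≤ ψ₀ x i ∧ 0 ≤ φT x i ∧ 0 ≤ ψT x i
  backward : ∀ᵐ z ∂(R₀), (∀ j, Integrable fun y => P z.2 j z.1 y * φT y j) ∧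
    φ₀ z.1 z.2 = ∑ j, ∫ y, P z.2 j z.1 y * φT y j
  forward : ∀ j, ∀ᵐ y, (∀ i, Integrable fun x => P i j x y * ψ₀ x i) ∧
    ψT y j = ∑ i, ∫ x, P i j x y * ψ₀ x i
  initial : ∀ i, ∀ᵐ x, q₀ x i = φ₀ x i * ψ₀ x i
  terminal : ∀ j, ∀ᵐ y, qT y j = φT y j * ψT y j

end RegimeSchrodinger

end

noncomputable section

namespace RegimeSchrodinger

/-! ### Contraction and fixed points for a pinched kernel on abstract measurable spaces. -/

section Kernel

variable {X Y : Type*} [MeasurableSpace X] [MeasurableSpace Y]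

/-! The regimes are absorbed into one state space carrying the sum of the Lebesgue measures, so that
the system involves a single kernel `K` and two probability measures `μ`, `ν` concentrated on sets
`A`, `B`. By compactness, `ε ≤ K ≤ M` on `A × B`. Proportionality is measured by the least `r` such
that `u / v` lies in some `[a, a (1 + r)]` on `B`. Inversion keeps `r`, and a pinched kernel
multiplies it by `1 - ε / M` (`NearlyProportional.kernelMap`), an elementary form of Birkhoff's
contraction theorem. A Fortet–Sinkhorn step applies the kernel twice and so contracts by `(1 - ε /
M) ^ 2`.

Contraction alone controls functions only up to scale. The scale is fixed by
`integral_inv_mul_step`: the `ν`-average of `C f / f` is one, so that if `f` is nearly proportional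
to `C f`, then the factor is close to one. Hence the logarithms of the unnormalized iterates form a
Cauchy sequence, uniformly on `B`, and no eigenvalue appears in the limiting equation
(`exists_fixedPoint_of_iterate`). Two positive fixed points are proportional with deviation `r * κ ^
k` for every `k`, hence exactly proportional (`eq_smul_of_fixedPoint`).

For uniqueness in the Schrödinger system the aim is to show that `ψT` is, up to `ν`-null sets, a
fixed point. The backward equation is available only where the initial density is non-zero, so `ψ₀`
might carry extra mass elsewhere. Comparing total masses (`IsFactorization.psi₀_mul_lintegral`)
shows that such mass does not interact with `φT`, and both equations reduce to the supports.

A competing fixed point is only assumed measurable and positive, so its reciprocal may fail to be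
integrable, in which case the integral has the default value zero.
`SchrodingerData.inv_of_fixedPoint` excludes this. -/

/-- The integral operator with kernel `K` with respect to the measure `ν`. -/
def kernelMap (K : X → Y → ℝ) (ν : Measure Y) (u : Y → ℝ) : X → ℝ :=
  fun x => ∫ y, K x y * u y ∂ν

/-- A measurable kernel with values in `[0, M]`, and with values in `[ε, M]` on `A × B`. -/
structure IsPinchedKernel (K : X → Y → ℝ) (A : Set X) (B : Set Y) (ε M : ℝ) : Prop where
  measurable : Measurable (Function.uncurry K)
  pos : 0 < ε
  eps_le : ε ≤ M
  nonneg : ∀ x y, 0 ≤ K x y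
  le : ∀ x y, K x y ≤ M
  lower : ∀ x ∈ A, ∀ y ∈ B, ε ≤ K x y

/-- Measurable, bounded, non-negative functions that are bounded away from zero on `B`. -/
structure IsPositiveOn (B : Set Y) (f : Y → ℝ) : Prop where
  measurable : Measurable f
  nonneg : ∀ y, 0 ≤ f y
  bounded : ∃ M : ℝ, ∀ y, f y ≤ M
  lower : ∃ c : ℝ, 0 < c ∧ ∀ y ∈ B, c ≤ f y

/-- One step of the Fortet–Sinkhorn iteration for the kernel `K` and the measures `μ`, `ν`. -/
def step (K : X → Y → ℝ) (μ : Measure X) (ν : Measure Y) (f : Y → ℝ) : Y → ℝ :=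
  kernelMap (flip K) μ (kernelMap K ν f⁻¹)⁻¹

/-- On `B`, the quotient `u / v` takes values in an interval `[a, a (1 + r)]` with `a > 0`. -/
def NearlyProportional (B : Set Y) (r : ℝ) (u v : Y → ℝ) : Prop :=
  ∃ a : ℝ, 0 < a ∧ ∀ y ∈ B, a * v y ≤ u y ∧ u y ≤ a * (1 + r) * v y

variable {K : X → Y → ℝ} {A : Set X} {B : Set Y} {ε M : ℝ} {μ : Measure X} {ν : Measure Y}
  {u v f g : Y → ℝ}

namespace IsPinchedKernel

lemma swap (hK : IsPinchedKernel K A B ε M) : IsPinchedKernel (flip K) B A ε M where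
  measurable := hK.measurable.comp measurable_swap
  pos := hK.pos
  eps_le := hK.eps_le
  nonneg y x := hK.nonneg x y
  le y x := hK.le x y
  lower y hy x hx := hK.lower x hx y hy

lemma integrable_mul (hK : IsPinchedKernel K A B ε M) (hu : Integrable u ν) (x : X) :
    Integrable (fun y => K x y * u y) ν :=
  hu.bdd_mul (c := M) hK.measurable.of_uncurry_left.aestronglyMeasurable <|
    Eventually.of_forall fun y => by
      rw [Real.norm_of_nonneg (hK.nonneg x y)]; exact hK.le x y

lemma kernelMap_nonneg (hK : IsPinchedKernel K A B ε M) (hu : 0 ≤ᵐ[ν] u) (x : X) :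
    0 ≤ kernelMap K ν u x :=
  integral_nonneg_of_ae <| hu.mono fun y hy => mul_nonneg (hK.nonneg x y) hy

lemma kernelMap_le (hK : IsPinchedKernel K A B ε M) (hu : Integrable u ν) (h0 : 0 ≤ᵐ[ν] u)
    (x : X) : kernelMap K ν u x ≤ M * ∫ y, u y ∂ν := by
  rw [← integral_const_mul]
  exact integral_mono_ae (hK.integrable_mul hu x) (hu.const_mul M) <|
    h0.mono fun y hy => mul_le_mul_of_nonneg_right (hK.le x y) hy

lemma le_kernelMap (hK : IsPinchedKernel K A B ε M) (hB : ∀ᵐ y ∂ν, y ∈ B)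
    (hu : Integrable u ν) (h0 : 0 ≤ᵐ[ν] u) {x : X} (hx : x ∈ A) :
    ε * ∫ y, u y ∂ν ≤ kernelMap K ν u x := by
  rw [← integral_const_mul]
  refine integral_mono_ae (hu.const_mul ε) (hK.integrable_mul hu x) ?_
  filter_upwards [h0, hB] with y hy hyB
  exact mul_le_mul_of_nonneg_right (hK.lower x hx y hyB) hy

lemma measurable_kernelMap (hK : IsPinchedKernel K A B ε M) [SFinite ν] (hu : Measurable u) :
    Measurable (kernelMap K ν u) :=
  (StronglyMeasurable.integral_prod_right (f := fun x y => K x y * u y) (ν := ν)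
    (hK.measurable.mul (hu.comp measurable_snd)).stronglyMeasurable).measurable

lemma isPositiveOn_kernelMap (hK : IsPinchedKernel K A B ε M) [SFinite ν]
    (hB : ∀ᵐ y ∂ν, y ∈ B) (hm : Measurable u) (hu : Integrable u ν) (h0 : 0 ≤ᵐ[ν] u)
    (hI : 0 < ∫ y, u y ∂ν) : IsPositiveOn A (kernelMap K ν u) where
  measurable := hK.measurable_kernelMap hm
  nonneg := hK.kernelMap_nonneg h0
  bounded := ⟨_, hK.kernelMap_le hu h0⟩
  lower := ⟨_, mul_pos hK.pos hI, fun _ hx => hK.le_kernelMap hB hu h0 hx⟩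

end IsPinchedKernel

omit [MeasurableSpace X] in
lemma kernelMap_congr_ae (K : X → Y → ℝ) (h : u =ᵐ[ν] v) : kernelMap K ν u = kernelMap K ν v :=
  funext fun x => integral_congr_ae <| h.mono fun y hy => by simp only [hy]

omit [MeasurableSpace X] in
lemma kernelMap_const_smul (K : X → Y → ℝ) (ν : Measure Y) (c : ℝ) (u : Y → ℝ) :
    kernelMap K ν (c • u) = c • kernelMap K ν u := by
  funext x
  simp only [kernelMap, Pi.smul_apply, smul_eq_mul, ← integral_const_mul]
  exact integral_congr_ae <| Eventually.of_forall fun y => by ring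

lemma inv_const_smul {Z : Type*} (a : ℝ) (w : Z → ℝ) : (a • w)⁻¹ = a⁻¹ • w⁻¹ := by
  funext z
  simp [mul_comm]

lemma step_congr_ae (K : X → Y → ℝ) (μ : Measure X) (h : f =ᵐ[ν] g) :
    step K μ ν f = step K μ ν g := by
  rw [step, step, kernelMap_congr_ae K (u := f⁻¹) (v := g⁻¹) (h.mono fun y hy => by simp [hy])]

/-- The two inversions cancel each other's effect on scalars, so the step has degree one. -/
lemma step_const_smul (K : X → Y → ℝ) (μ : Measure X) (ν : Measure Y) (c : ℝ) (f : Y → ℝ) :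
    step K μ ν (c • f) = c • step K μ ν f := by
  rw [step, step, inv_const_smul, kernelMap_const_smul, inv_const_smul, inv_inv,
    kernelMap_const_smul]

namespace IsPositiveOn

lemma pos (hf : IsPositiveOn B f) {y : Y} (hy : y ∈ B) : 0 < f y := by
  obtain ⟨c, hc, h⟩ := hf.lower
  exact hc.trans_le (h y hy)

lemma integrable_inv [IsFiniteMeasure ν] (hf : IsPositiveOn B f) (hB : ∀ᵐ y ∂ν, y ∈ B) :
    Integrable f⁻¹ ν := by
  obtain ⟨c, hc, h⟩ := hf.lower
  refine Integrable.of_bound hf.measurable.inv.aestronglyMeasurable c⁻¹ (hB.mono fun y hy => ?_)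
  rw [Pi.inv_apply, Real.norm_of_nonneg (inv_nonneg.2 (hf.nonneg y))]
  exact inv_anti₀ hc (h y hy)

lemma inv_nonneg (hf : IsPositiveOn B f) : 0 ≤ f⁻¹ := fun y => _root_.inv_nonneg.2 (hf.nonneg y)

lemma integral_inv_pos [NeZero ν] [IsFiniteMeasure ν] (hf : IsPositiveOn B f)
    (hB : ∀ᵐ y ∂ν, y ∈ B) : 0 < ∫ y, f⁻¹ y ∂ν := by
  rw [integral_pos_iff_support_of_nonneg hf.inv_nonneg (hf.integrable_inv hB), pos_iff_ne_zero]
  intro h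
  have h2 : ∀ᵐ y ∂ν, False := by
    filter_upwards [hB, measure_eq_zero_iff_ae_notMem.1 h] with y hy hy'
    exact hy' (by simpa using (hf.pos hy).ne')
  exact NeZero.ne ν (ae_eq_bot.1 (eventually_false_iff_eq_bot.1 h2))

lemma const_smul (hf : IsPositiveOn B f) {c : ℝ} (hc : 0 < c) : IsPositiveOn B (c • f) where
  measurable := hf.measurable.const_smul c
  nonneg y := mul_nonneg hc.le (hf.nonneg y)
  bounded := by
    obtain ⟨C, hC⟩ := hf.bounded
    exact ⟨c * C, fun y => mul_le_mul_of_nonneg_left (hC y) hc.le⟩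
  lower := by
    obtain ⟨a, ha, h⟩ := hf.lower
    exact ⟨c * a, mul_pos hc ha, fun y hy => mul_le_mul_of_nonneg_left (h y hy) hc.le⟩

lemma nearlyProportional (hf : IsPositiveOn B f) (hg : IsPositiveOn B g) :
    ∃ r, 0 ≤ r ∧ NearlyProportional B r f g := by
  obtain ⟨C, hC⟩ := hf.bounded
  obtain ⟨D, hD⟩ := hg.bounded
  obtain ⟨c, hc, hfc⟩ := hf.lower
  obtain ⟨d, hd, hgd⟩ := hg.lower
  -- The maxima keep the upper bounds above the lower ones even if `B` is empty, which gives `0 ≤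
  -- r`.
  have hD' : 0 < max D d := lt_max_of_lt_right hd
  have hC' : c ≤ max C c := le_max_right _ _
  have h1 : 1 ≤ max C c * max D d / (c * d) := by
    rw [le_div_iff₀ (by positivity), one_mul]
    exact mul_le_mul hC' (le_max_right _ _) hd.le (hc.le.trans hC')
  refine ⟨max C c * max D d / (c * d) - 1, by linarith, c / max D d, by positivity,
    fun y hy => ⟨?_, ?_⟩⟩
  · rw [div_mul_eq_mul_div, div_le_iff₀ hD']
    exact mul_le_mul (hfc y hy) ((hD y).trans (le_max_left _ _)) (hg.nonneg y) (hf.nonneg y)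
  · have : c / max D d * (1 + (max C c * max D d / (c * d) - 1)) * g y
        = max C c * (g y / d) := by
      field_simp; ring
    rw [this]
    have h2 : 1 ≤ g y / d := (one_le_div hd).2 (hgd y hy)
    nlinarith [hC y, le_max_left C c, hf.nonneg y]

end IsPositiveOn

/-- The kernel regularizes: an integrable, non-trivial reciprocal is enough, and `f` itself need be
neither bounded nor bounded away from zero. This turns almost everywhere fixed points into genuine
ones. -/
lemma IsPinchedKernel.isPositiveOn_step (hK : IsPinchedKernel K A B ε M)
    [IsProbabilityMeasure μ] [SFinite ν] (hA : ∀ᵐ x ∂μ, x ∈ A) (hB : ∀ᵐ y ∂ν, y ∈ B)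
    (hm : Measurable f) (hi : Integrable f⁻¹ ν) (h0 : 0 ≤ᵐ[ν] f⁻¹) (hI : 0 < ∫ y, f⁻¹ y ∂ν) :
    IsPositiveOn B (step K μ ν f) := by
  have h := hK.isPositiveOn_kernelMap hB hm.inv hi h0 hI
  exact hK.swap.isPositiveOn_kernelMap hA h.measurable.inv (h.integrable_inv hA)
    (Eventually.of_forall h.inv_nonneg) (h.integral_inv_pos hA)

lemma IsPositiveOn.kernelMap_inv (hK : IsPinchedKernel K A B ε M)
    [IsProbabilityMeasure ν] (hB : ∀ᵐ y ∂ν, y ∈ B) (hf : IsPositiveOn B f) :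
    IsPositiveOn A (kernelMap K ν f⁻¹) :=
  hK.isPositiveOn_kernelMap hB hf.measurable.inv (hf.integrable_inv hB)
    (Eventually.of_forall hf.inv_nonneg) (hf.integral_inv_pos hB)

lemma IsPositiveOn.step (hK : IsPinchedKernel K A B ε M)
    [IsProbabilityMeasure μ] [IsProbabilityMeasure ν] (hA : ∀ᵐ x ∂μ, x ∈ A)
    (hB : ∀ᵐ y ∂ν, y ∈ B) (hf : IsPositiveOn B f) : IsPositiveOn B (step K μ ν f) :=
  (hf.kernelMap_inv hK hB).kernelMap_inv hK.swap hA

lemma IsPositiveOn.iterate_step (hK : IsPinchedKernel K A B ε M)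
    [IsProbabilityMeasure μ] [IsProbabilityMeasure ν] (hA : ∀ᵐ x ∂μ, x ∈ A)
    (hB : ∀ᵐ y ∂ν, y ∈ B) (hf : IsPositiveOn B f) (k : ℕ) :
    IsPositiveOn B ((RegimeSchrodinger.step K μ ν)^[k] f) := by
  induction k with
  | zero => exact hf
  | succ k ih => rw [Function.iterate_succ_apply']; exact ih.step hK hA hB

-- The reciprocal quotient lies in `[1 / (a (1 + r)), 1 / a]`, whose endpoints have the same ratio
-- `1 + r`.
omit [MeasurableSpace Y] in
lemma NearlyProportional.inv {r : ℝ} (h : NearlyProportional B r f g) (hr : 0 ≤ r)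
    (hf : ∀ y ∈ B, 0 < f y) (hg : ∀ y ∈ B, 0 < g y) : NearlyProportional B r f⁻¹ g⁻¹ := by
  obtain ⟨a, ha, h⟩ := h
  refine ⟨(a * (1 + r))⁻¹, by positivity, fun y hy => ?_⟩
  have h1 := hf y hy
  have h2 := hg y hy
  simp only [Pi.inv_apply]
  constructor
  · rw [← mul_inv]
    exact inv_anti₀ h1 (h y hy).2
  · have : (a * (1 + r))⁻¹ * (1 + r) * (g y)⁻¹ = (a * g y)⁻¹ := by field_simp
    rw [this]
    exact inv_anti₀ (by positivity) (h y hy).1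

/-- A pinched kernel contracts the deviation from proportionality by the factor `1 - ε / M`. -/
lemma NearlyProportional.kernelMap {r : ℝ} (h : NearlyProportional B r u v)
    (hK : IsPinchedKernel K A B ε M) (hr : 0 ≤ r) (hB : ∀ᵐ y ∂ν, y ∈ B)
    (hu : Integrable u ν) (hv : Integrable v ν) (hv0 : 0 ≤ᵐ[ν] v) (hI : 0 < ∫ y, v y ∂ν) :
    NearlyProportional A ((1 - ε / M) * r) (kernelMap K ν u) (kernelMap K ν v) := by
  obtain ⟨a, ha, h⟩ := h
  have hM : 0 < M := hK.pos.trans_le hK.eps_le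
  have hδ : 0 < ε / M := div_pos hK.pos hM
  have hδ1 : ε / M ≤ 1 := (div_le_one hM).2 hK.eps_le
  set δ := ε / M with hδdef
  have hεδ : ε = δ * M := by rw [hδdef]; field_simp
  set I := ∫ y, v y ∂ν
  set J := ∫ y, u y ∂ν
  have hw1 : 0 ≤ᵐ[ν] fun y => u y - a * v y := hB.mono fun y hy => by
    simpa using (h y hy).1
  have hw2 : 0 ≤ᵐ[ν] fun y => a * (1 + r) * v y - u y := hB.mono fun y hy => by
    simpa using (h y hy).2
  have hJ : 0 ≤ J - a * I := by
    have := integral_nonneg_of_ae hw1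
    rwa [integral_sub hu (hv.const_mul a), integral_const_mul] at this
  -- The lower factor gains `δ` times the mean excess of `u` over `a v`, relative to the mass of
  -- `v`.
  refine ⟨a + δ * ((J - a * I) / I), by positivity, fun x hx => ?_⟩
  have hvx := hK.kernelMap_le hv hv0 x
  have hvx0 := hK.kernelMap_nonneg hv0 x
  -- For non-negative `w = b u + c v`, the bounds `K w ≥ ε ∫ w` and `K v ≤ M ∫ v` combine to `K w ≥
  -- (ε / M) (∫ w / ∫ v) K v`. This is used for the gaps `u - a v` and `a (1 + r) v - u`.
  have key (b c : ℝ) (hw : 0 ≤ᵐ[ν] fun y => b * u y + c * v y) :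
      δ * ((b * J + c * I) / I) * RegimeSchrodinger.kernelMap K ν v x
        ≤ b * RegimeSchrodinger.kernelMap K ν u x + c * RegimeSchrodinger.kernelMap K ν v x := by
    have h1 := hK.le_kernelMap hB ((hu.const_mul b).add (hv.const_mul c)) hw hx
    have h2 : ∫ y, ((fun y => b * u y) + fun y => c * v y) y ∂ν = b * J + c * I := by
      rw [integral_add' (hu.const_mul b) (hv.const_mul c), integral_const_mul, integral_const_mul]
    have h3 : RegimeSchrodinger.kernelMap K ν ((fun y => b * u y) + fun y => c * v y) x
        = b * RegimeSchrodinger.kernelMap K ν u x + c * RegimeSchrodinger.kernelMap K ν v x := by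
      simp only [RegimeSchrodinger.kernelMap]
      rw [← integral_const_mul, ← integral_const_mul,
        ← integral_add ((hK.integrable_mul hu x).const_mul b)
          ((hK.integrable_mul hv x).const_mul c)]
      exact integral_congr_ae <| Eventually.of_forall fun y => by simp only [Pi.add_apply]; ring
    have h4 : 0 ≤ b * J + c * I := by
      rw [← h2]; exact integral_nonneg_of_ae hw
    rw [h2, h3] at h1
    refine le_trans ?_ h1
    calc δ * ((b * J + c * I) / I) * RegimeSchrodinger.kernelMap K ν v x
        ≤ δ * ((b * J + c * I) / I) * (M * I) := by gcongr
      _ = ε * (b * J + c * I) := by rw [hεδ]; field_simp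
  have k1 := key 1 (-a) (by convert hw1 using 2; ring)
  have k2 := key (-1) (a * (1 + r)) (by convert hw2 using 2; ring)
  have e1 : (1 * J + -a * I) / I = (J - a * I) / I := by ring
  have e2 : (-1 * J + a * (1 + r) * I) / I = a * r - (J - a * I) / I := by field_simp; ring
  rw [e1] at k1
  rw [e2] at k2
  have hs : 0 ≤ δ * ((J - a * I) / I) := by positivity
  set s := (J - a * I) / I
  set V := RegimeSchrodinger.kernelMap K ν v x
  constructor
  · linarith
  -- The upper factor from `k2` is `a + a (1 - δ) r + δ s`; it falls short of `(a + δ s) (1 + (1 -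
  -- δ) r)` by exactly `δ s (1 - δ) r`.
  · have : 0 ≤ δ * s * ((1 - δ) * r) * V :=
      mul_nonneg (mul_nonneg hs (mul_nonneg (by linarith) hr)) hvx0
    nlinarith

/-- The contraction property of one step of the iteration. -/
lemma NearlyProportional.step {r : ℝ} (h : NearlyProportional B r f g)
    (hK : IsPinchedKernel K A B ε M) [IsProbabilityMeasure μ] [IsProbabilityMeasure ν]
    (hr : 0 ≤ r) (hA : ∀ᵐ x ∂μ, x ∈ A) (hB : ∀ᵐ y ∂ν, y ∈ B)
    (hf : IsPositiveOn B f) (hg : IsPositiveOn B g) :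
    NearlyProportional B ((1 - ε / M) * ((1 - ε / M) * r)) (step K μ ν f) (step K μ ν g) := by
  have hδ : 0 ≤ 1 - ε / M :=
    sub_nonneg.2 ((div_le_one (hK.pos.trans_le hK.eps_le)).2 hK.eps_le)
  have h1 := (h.inv hr (fun _ => hf.pos) (fun _ => hg.pos)).kernelMap hK hr hB
    (hf.integrable_inv hB) (hg.integrable_inv hB) (Eventually.of_forall hg.inv_nonneg)
    (hg.integral_inv_pos hB)
  have hf' := hf.kernelMap_inv hK hB
  have hg' := hg.kernelMap_inv hK hB
  exact (h1.inv (mul_nonneg hδ hr) (fun _ => hf'.pos) (fun _ => hg'.pos)).kernelMap hK.swap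
    (mul_nonneg hδ hr) hA (hf'.integrable_inv hA) (hg'.integrable_inv hA)
    (Eventually.of_forall hg'.inv_nonneg) (hg'.integral_inv_pos hA)

lemma NearlyProportional.iterate_step {r : ℝ} (h : NearlyProportional B r f g)
    (hK : IsPinchedKernel K A B ε M) [IsProbabilityMeasure μ] [IsProbabilityMeasure ν]
    (hr : 0 ≤ r) (hA : ∀ᵐ x ∂μ, x ∈ A) (hB : ∀ᵐ y ∂ν, y ∈ B)
    (hf : IsPositiveOn B f) (hg : IsPositiveOn B g) (k : ℕ) :
    NearlyProportional B (r * ((1 - ε / M) ^ 2) ^ k)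
      ((RegimeSchrodinger.step K μ ν)^[k] f) ((RegimeSchrodinger.step K μ ν)^[k] g) := by
  induction k with
  | zero => simpa using h
  | succ k ih =>
    rw [Function.iterate_succ_apply', Function.iterate_succ_apply']
    convert ih.step hK (by positivity) hA hB (hf.iterate_step hK hA hB k)
      (hg.iterate_step hK hA hB k) using 1
    ring

/-- The average of `C f / f` with respect to the terminal distribution is one. -/
lemma integral_inv_mul_step (hK : IsPinchedKernel K A B ε M) [IsProbabilityMeasure μ]
    [IsProbabilityMeasure ν] (hA : ∀ᵐ x ∂μ, x ∈ A) (hB : ∀ᵐ y ∂ν, y ∈ B)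
    (hf : IsPositiveOn B f) : ∫ y, (f y)⁻¹ * step K μ ν f y ∂ν = 1 := by
  have hh := hf.kernelMap_inv hK hB
  set h := kernelMap K ν f⁻¹ with hdef
  have hint : Integrable (Function.uncurry fun y x => flip K y x * ((f y)⁻¹ * (h x)⁻¹))
      (ν.prod μ) := by
    refine ((hf.integrable_inv hB).mul_prod (hh.integrable_inv hA)).bdd_mul (c := M)
      hK.swap.measurable.aestronglyMeasurable (Eventually.of_forall fun z => ?_)
    rw [Real.norm_of_nonneg (hK.swap.nonneg _ _)]
    exact hK.swap.le _ _
  -- After Fubini the inner integral over `y` reproduces `h x`, which cancels the factor `(h x)⁻¹`.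
  calc ∫ y, (f y)⁻¹ * step K μ ν f y ∂ν
      = ∫ y, ∫ x, flip K y x * ((f y)⁻¹ * (h x)⁻¹) ∂μ ∂ν := by
        refine integral_congr_ae <| Eventually.of_forall fun y => ?_
        simp only [step, kernelMap, ← integral_const_mul]
        exact integral_congr_ae <| Eventually.of_forall fun x => by
          simp only [Pi.inv_apply, hdef, kernelMap]; ring
    _ = ∫ x, ∫ y, flip K y x * ((f y)⁻¹ * (h x)⁻¹) ∂ν ∂μ := integral_integral_swap hint
    _ = ∫ x, (1 : ℝ) ∂μ := by
        refine integral_congr_ae <| hA.mono fun x hx => ?_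
        have : (fun y => flip K y x * ((f y)⁻¹ * (h x)⁻¹))
            = fun y => (h x)⁻¹ * (K x y * f⁻¹ y) := by
          funext y; simp only [flip, Pi.inv_apply]; ring
        simp only [this, integral_const_mul]
        exact inv_mul_cancel₀ (hh.pos hx).ne'
    _ = 1 := by simp

lemma abs_log_sub_log_le {a b r : ℝ} (ha : 0 < a) (hb : 0 < b) (hr : 0 ≤ r)
    (h1 : a ≤ (1 + r) * b) (h2 : b ≤ (1 + r) * a) : |Real.log a - Real.log b| ≤ r := by
  have hl : Real.log (1 + r) ≤ r := by
    have := Real.log_le_sub_one_of_pos (show 0 < 1 + r by linarith); linarith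
  have e1 := Real.log_le_log ha h1
  have e2 := Real.log_le_log hb h2
  rw [Real.log_mul (by linarith) hb.ne'] at e1
  rw [Real.log_mul (by linarith) ha.ne'] at e2
  rw [abs_le]; constructor <;> linarith

/-- If `f` is nearly proportional to `C f`, then it is close to `C f`. -/
lemma NearlyProportional.abs_log_sub_log_step_le {r : ℝ}
    (hK : IsPinchedKernel K A B ε M) [IsProbabilityMeasure μ] [IsProbabilityMeasure ν]
    (hr : 0 ≤ r) (hA : ∀ᵐ x ∂μ, x ∈ A) (hB : ∀ᵐ y ∂ν, y ∈ B) (hf : IsPositiveOn B f)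
    (h : NearlyProportional B r f (RegimeSchrodinger.step K μ ν f)) {y : Y} (hy : y ∈ B) :
    |Real.log (f y) - Real.log (RegimeSchrodinger.step K μ ν f y)| ≤ r := by
  obtain ⟨a, ha, h⟩ := h
  have hs := hf.step hK hA hB
  have h1 := integral_inv_mul_step hK hA hB hf
  have hint : Integrable (fun y => (f y)⁻¹ * RegimeSchrodinger.step K μ ν f y) ν := by
    obtain ⟨C, hC⟩ := hs.bounded
    refine (hf.integrable_inv hB).mul_bdd (c := C) hs.measurable.aestronglyMeasurable
      (Eventually.of_forall fun z => ?_)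
    rw [Real.norm_of_nonneg (hs.nonneg z)]; exact hC z
  -- Integrating `a ≤ f / C f ≤ a (1 + r)`, after multiplication by `C f / f`, against `ν` gives `a
  -- ≤ 1 ≤ a (1 + r)`.
  have ha1 : a ≤ 1 := by
    have : ∫ y, a * ((f y)⁻¹ * RegimeSchrodinger.step K μ ν f y) ∂ν ≤ ∫ _, (1 : ℝ) ∂ν := by
      refine integral_mono_ae (hint.const_mul a) (integrable_const _) (hB.mono fun z hz => ?_)
      have := (h z hz).1
      have hfz := hf.pos hz
      calc a * ((f z)⁻¹ * RegimeSchrodinger.step K μ ν f z)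
          = (f z)⁻¹ * (a * RegimeSchrodinger.step K μ ν f z) := by ring
        _ ≤ (f z)⁻¹ * f z := by gcongr
        _ = 1 := inv_mul_cancel₀ hfz.ne'
    rw [integral_const_mul, h1] at this
    simpa using this
  have ha2 : 1 ≤ a * (1 + r) := by
    have : ∫ _, (1 : ℝ) ∂ν ≤
        ∫ y, a * (1 + r) * ((f y)⁻¹ * RegimeSchrodinger.step K μ ν f y) ∂ν := by
      refine integral_mono_ae (integrable_const _) (hint.const_mul _) (hB.mono fun z hz => ?_)
      have := (h z hz).2
      have hfz := hf.pos hz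
      calc (1 : ℝ) = (f z)⁻¹ * f z := (inv_mul_cancel₀ hfz.ne').symm
        _ ≤ (f z)⁻¹ * (a * (1 + r) * RegimeSchrodinger.step K μ ν f z) := by gcongr
        _ = a * (1 + r) * ((f z)⁻¹ * RegimeSchrodinger.step K μ ν f z) := by ring
    rw [integral_const_mul, h1] at this
    simpa using this
  obtain ⟨k1, k2⟩ := h y hy
  have hfy := hf.pos hy
  have hsy := hs.pos hy
  refine abs_log_sub_log_le hfy hsy hr ?_ ?_
  · nlinarith [mul_pos (show 0 < 1 + r by linarith) hsy]
  · calc RegimeSchrodinger.step K μ ν f y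
        ≤ a * (1 + r) * RegimeSchrodinger.step K μ ν f y := by nlinarith
      _ = (1 + r) * (a * RegimeSchrodinger.step K μ ν f y) := by ring
      _ ≤ (1 + r) * f y := by gcongr

/-- An upper bound `f ≤ exp η * g` becomes `g⁻¹ ≤ exp η * f⁻¹`, and integration against a
non-negative kernel preserves it. Applying this twice, for `K` and for its transpose, restores the
order. -/
lemma log_kernelMap_inv_le (hK : IsPinchedKernel K A B ε M) [IsProbabilityMeasure ν]
    (hB : ∀ᵐ y ∂ν, y ∈ B) (hf : IsPositiveOn B f) (hg : IsPositiveOn B g) {η : ℝ}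
    (h : ∀ y ∈ B, Real.log (f y) ≤ Real.log (g y) + η) {x : X} (hx : x ∈ A) :
    Real.log (kernelMap K ν g⁻¹ x) ≤ Real.log (kernelMap K ν f⁻¹ x) + η := by
  have hf' := (hf.kernelMap_inv hK hB).pos hx
  have hg' := (hg.kernelMap_inv hK hB).pos hx
  have key : kernelMap K ν g⁻¹ x ≤ Real.exp η * kernelMap K ν f⁻¹ x := by
    simp only [kernelMap, ← integral_const_mul]
    refine integral_mono_ae (hK.integrable_mul (hg.integrable_inv hB) x)
      ((hK.integrable_mul (hf.integrable_inv hB) x).const_mul _) (hB.mono fun y hy => ?_)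
    have hfy := hf.pos hy
    have hgy := hg.pos hy
    have h1 : f y ≤ Real.exp η * g y := by
      have := Real.exp_le_exp.2 (h y hy)
      rwa [Real.exp_add, Real.exp_log hfy, Real.exp_log hgy, mul_comm] at this
    have h2 : (g y)⁻¹ ≤ Real.exp η * (f y)⁻¹ := by
      rw [← div_eq_mul_inv, le_div_iff₀ hfy, inv_mul_le_iff₀ hgy]
      linarith
    calc K x y * g⁻¹ y ≤ K x y * (Real.exp η * f⁻¹ y) :=
          mul_le_mul_of_nonneg_left h2 (hK.nonneg x y)
      _ = Real.exp η * (K x y * f⁻¹ y) := by ring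
  have := Real.log_le_log hg' key
  rwa [Real.log_mul (Real.exp_pos η).ne' hf'.ne', Real.log_exp, add_comm] at this

/-- Steps are order preserving and homogeneous, hence non-expansive for `|log f - log g|`. -/
lemma abs_log_step_sub_log_step_le (hK : IsPinchedKernel K A B ε M)
    [IsProbabilityMeasure μ] [IsProbabilityMeasure ν] (hA : ∀ᵐ x ∂μ, x ∈ A)
    (hB : ∀ᵐ y ∂ν, y ∈ B) (hf : IsPositiveOn B f) (hg : IsPositiveOn B g) {η : ℝ}
    (h : ∀ y ∈ B, |Real.log (f y) - Real.log (g y)| ≤ η) {y : Y} (hy : y ∈ B) :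
    |Real.log (step K μ ν f y) - Real.log (step K μ ν g y)| ≤ η := by
  have hf' := hf.kernelMap_inv hK hB
  have hg' := hg.kernelMap_inv hK hB
  have e1 := log_kernelMap_inv_le hK.swap hA hf' hg' (fun x hx =>
    log_kernelMap_inv_le hK hB hg hf (fun z hz => by
      have := (abs_le.1 (h z hz)).1; linarith) hx) hy
  have e2 := log_kernelMap_inv_le hK.swap hA hg' hf' (fun x hx =>
    log_kernelMap_inv_le hK hB hf hg (fun z hz => by
      have := (abs_le.1 (h z hz)).2; linarith) hx) hy
  simp only [step]
  rw [abs_le]; constructor <;> linarith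

lemma contraction_factor (hK : IsPinchedKernel K A B ε M) :
    0 ≤ (1 - ε / M) ^ 2 ∧ (1 - ε / M) ^ 2 < 1 := by
  have hM := hK.pos.trans_le hK.eps_le
  have h1 := (div_le_one hM).2 hK.eps_le
  have h2 := div_pos hK.pos hM
  exact ⟨sq_nonneg _, by nlinarith⟩

/-- The iterates converge to a fixed point, uniformly on the logarithmic scale. -/
lemma exists_fixedPoint_of_iterate (hK : IsPinchedKernel K A B ε M) (hBm : MeasurableSet B)
    [IsProbabilityMeasure μ] [IsProbabilityMeasure ν] (hA : ∀ᵐ x ∂μ, x ∈ A)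
    (hB : ∀ᵐ y ∂ν, y ∈ B) (hf : IsPositiveOn B f) :
    ∃ F : Y → ℝ, IsPositiveOn B F ∧ step K μ ν F = F ∧ ∃ η : ℕ → ℝ, Tendsto η atTop (𝓝 0) ∧
      ∀ k, ∀ y ∈ B, |Real.log ((step K μ ν)^[k] f y) - Real.log (F y)| ≤ η k := by
  obtain ⟨r, hr, hnp⟩ := hf.nearlyProportional (hf.step hK hA hB)
  obtain ⟨hκ0, hκ1⟩ := contraction_factor hK
  set κ := (1 - ε / M) ^ 2
  have hpos (k : ℕ) := hf.iterate_step hK hA hB k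
  have hstep (k : ℕ) {y : Y} (hy : y ∈ B) :
      |Real.log ((step K μ ν)^[k] f y) - Real.log ((step K μ ν)^[k + 1] f y)| ≤ r * κ ^ k := by
    have h := hnp.iterate_step hK hr hA hB hf (hf.step hK hA hB) k
    rw [← Function.iterate_succ_apply, Function.iterate_succ_apply'] at h
    rw [Function.iterate_succ_apply']
    exact h.abs_log_sub_log_step_le hK (by positivity) hA hB (hpos k) hy
  -- Nothing is known about convergence off `B`; cutting off there gives a limit at every point,
  -- hence a measurable one.
  let l : ℕ → Y → ℝ := fun k => B.indicator fun y => Real.log ((step K μ ν)^[k] f y)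
  have hl (y : Y) (k : ℕ) : dist (l k y) (l (k + 1) y) ≤ r * κ ^ k := by
    by_cases hy : y ∈ B
    · simpa [l, hy, Real.dist_eq] using hstep k hy
    · simp [l, hy]; positivity
  have hlim (y : Y) : ∃ b, Tendsto (fun k => l k y) atTop (𝓝 b) :=
    cauchySeq_tendsto_of_complete (cauchySeq_of_le_geometric κ r hκ1 (hl y))
  choose G hG using hlim
  have hGm : Measurable G := measurable_of_tendsto_metrizable
    (fun k => ((hpos k).measurable.log).indicator hBm) (tendsto_pi_nhds.2 hG)
  have hdist (k : ℕ) {y : Y} (hy : y ∈ B) :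
      |Real.log ((step K μ ν)^[k] f y) - G y| ≤ r * κ ^ k / (1 - κ) := by
    simpa [l, hy, Real.dist_eq] using
      dist_le_of_le_geometric_of_tendsto κ r hκ1 (hl y) (hG y) k
  have hη : Tendsto (fun k : ℕ => r * κ ^ k / (1 - κ)) atTop (𝓝 0) := by
    simpa using ((tendsto_pow_atTop_nhds_zero_of_lt_one hκ0 hκ1).const_mul r).div_const (1 - κ)
  obtain ⟨C, hC⟩ := hf.bounded
  obtain ⟨c, hc, hcf⟩ := hf.lower
  have hG0 : ∀ y ∈ B, |Real.log (f y) - G y| ≤ r / (1 - κ) := fun y hy => by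
    simpa using hdist 0 hy
  let H : Y → ℝ := B.indicator fun y => Real.exp (G y)
  have hH : IsPositiveOn B H := by
    refine ⟨hGm.exp.indicator hBm, fun y => Set.indicator_nonneg (fun _ _ => (Real.exp_pos _).le) y,
      ⟨Real.exp (Real.log (max C c) + r / (1 - κ)), fun y => ?_⟩,
      ⟨Real.exp (Real.log c - r / (1 - κ)), Real.exp_pos _, fun y hy => ?_⟩⟩
    · refine Set.indicator_le' (fun y hy => ?_) (fun _ _ => (Real.exp_pos _).le) y
      have h1 := Real.log_le_log (hf.pos hy) ((hC y).trans (le_max_left C c))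
      have h2 := (abs_le.1 (hG0 y hy)).1
      exact Real.exp_le_exp.2 (by linarith)
    · simp only [H, Set.indicator_of_mem hy]
      have h1 := Real.log_le_log hc (hcf y hy)
      have h2 := (abs_le.1 (hG0 y hy)).2
      exact Real.exp_le_exp.2 (by linarith)
  have hHlog (k : ℕ) : ∀ y ∈ B,
      |Real.log ((step K μ ν)^[k] f y) - Real.log (H y)| ≤ r * κ ^ k / (1 - κ) := fun y hy => by
    simpa [H, hy] using hdist k hy
  -- Non-expansiveness makes the shifted iterates converge to `C H` as well as to `H` on `B`.
  have hfix : ∀ y ∈ B, step K μ ν H y = H y := by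
    intro y hy
    refine Real.log_injOn_pos ((hH.step hK hA hB).pos hy) (hH.pos hy) ?_
    refine tendsto_nhds_unique (f := fun k => Real.log ((step K μ ν)^[k + 1] f y)) (l := atTop)
      ?_ ?_
    · refine tendsto_iff_dist_tendsto_zero.2 (squeeze_zero (fun _ => dist_nonneg) (fun k => ?_) hη)
      rw [Function.iterate_succ_apply', Real.dist_eq]
      exact abs_log_step_sub_log_step_le hK hA hB (hpos k) hH (hHlog k) hy
    · refine tendsto_iff_dist_tendsto_zero.2 (squeeze_zero (fun _ => dist_nonneg) (fun k => ?_)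
        ((tendsto_add_atTop_iff_nat 1).2 hη))
      exact hHlog (k + 1) y hy
  -- `H` solves the equation only on `B`. As a step depends only on `ν`-a.e. values, `C H` solves it
  -- everywhere and agrees with `H` on `B`.
  refine ⟨step K μ ν H, hH.step hK hA hB, step_congr_ae K μ (hB.mono hfix), _, hη,
    fun k y hy => ?_⟩
  rw [hfix y hy]
  exact hHlog k y hy

/-- Positive fixed points are unique up to scaling. -/
lemma eq_smul_of_fixedPoint (hK : IsPinchedKernel K A B ε M)
    [IsProbabilityMeasure μ] [IsProbabilityMeasure ν] (hA : ∀ᵐ x ∂μ, x ∈ A)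
    (hB : ∀ᵐ y ∂ν, y ∈ B) (hf : IsPositiveOn B f) (hg : IsPositiveOn B g)
    (hf' : step K μ ν f = f) (hg' : step K μ ν g = g) : ∃ c : ℝ, 0 < c ∧ g = c • f := by
  obtain ⟨r, hr, hnp⟩ := hf.nearlyProportional hg
  obtain ⟨hκ0, hκ1⟩ := contraction_factor hK
  have hnp' (k : ℕ) : NearlyProportional B (r * ((1 - ε / M) ^ 2) ^ k) f g := by
    have := hnp.iterate_step hK hr hA hB hf hg k
    rwa [Function.iterate_fixed hf', Function.iterate_fixed hg'] at this
  -- Letting `k → ∞` in the deviation bound compares `f / g` at any two points of `B`; by symmetry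
  -- the quotient is constant there.
  have hle {y y' : Y} (hy : y ∈ B) (hy' : y' ∈ B) : f y * g y' ≤ f y' * g y := by
    have hlim : Tendsto (fun k : ℕ => (1 + r * ((1 - ε / M) ^ 2) ^ k) * (f y' * g y)) atTop
        (𝓝 ((1 + r * 0) * (f y' * g y))) :=
      (((tendsto_pow_atTop_nhds_zero_of_lt_one hκ0 hκ1).const_mul r).const_add 1).mul_const _
    rw [mul_zero, add_zero, one_mul] at hlim
    refine ge_of_tendsto' hlim fun k => ?_
    obtain ⟨a, ha, h⟩ := hnp' k
    have h1 := (h y hy).2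
    have h2 := (h y' hy').1
    have hgy := hg.pos hy
    have hgy' := hg.pos hy'
    calc f y * g y' ≤ a * (1 + r * ((1 - ε / M) ^ 2) ^ k) * g y * g y' := by gcongr
      _ = (1 + r * ((1 - ε / M) ^ 2) ^ k) * ((a * g y') * g y) := by ring
      _ ≤ (1 + r * ((1 - ε / M) ^ 2) ^ k) * (f y' * g y) := by gcongr
  obtain ⟨y₀, hy₀⟩ := hB.exists
  refine ⟨g y₀ / f y₀, div_pos (hg.pos hy₀) (hf.pos hy₀), ?_⟩
  have hBeq : ∀ y ∈ B, g y = ((g y₀ / f y₀) • f) y := fun y hy => by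
    rw [Pi.smul_apply, smul_eq_mul, div_mul_eq_mul_div, eq_div_iff (hf.pos hy₀).ne']
    linarith [hle hy hy₀, hle hy₀ hy]
  -- Proportionality on `B` extends to all of `Y` through the fixed point equation.
  calc g = step K μ ν g := hg'.symm
    _ = step K μ ν ((g y₀ / f y₀) • f) := step_congr_ae K μ (hB.mono hBeq)
    _ = (g y₀ / f y₀) • f := by rw [step_const_smul, hf']

end Kernel

/-! ### Factorizations of densities: reducing the Schrödinger system to a fixed point equation. -/

section Density

variable {X Y : Type*} [MeasurableSpace X] [MeasurableSpace Y]

/-- The measure with the real-valued density `q` with respect to `vol`. -/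
def densityMeasure (vol : Measure X) (q : X → ℝ) : Measure X :=
  vol.withDensity fun x => ENNReal.ofReal (q x)

variable {vol : Measure X} {q : X → ℝ}

instance [SFinite vol] : SFinite (densityMeasure vol q) := by
  unfold densityMeasure; infer_instance

lemma integral_densityMeasure (hq : Measurable q) (h0 : ∀ x, 0 ≤ q x) (g : X → ℝ) :
    ∫ x, g x ∂(densityMeasure vol q) = ∫ x, q x * g x ∂vol := by
  rw [densityMeasure, integral_withDensity_eq_integral_toReal_smul hq.ennreal_ofReal
    (Eventually.of_forall fun _ => ENNReal.ofReal_lt_top)]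
  simp only [ENNReal.toReal_ofReal (h0 _), smul_eq_mul]

lemma integrable_densityMeasure_iff (hq : Measurable q) (h0 : ∀ x, 0 ≤ q x) {g : X → ℝ} :
    Integrable g (densityMeasure vol q) ↔ Integrable (fun x => q x * g x) vol := by
  rw [densityMeasure, integrable_withDensity_iff_integrable_smul' hq.ennreal_ofReal
    (Eventually.of_forall fun _ => ENNReal.ofReal_lt_top)]
  simp only [ENNReal.toReal_ofReal (h0 _), smul_eq_mul]

lemma ae_densityMeasure_iff (hq : Measurable q) (h0 : ∀ x, 0 ≤ q x) {s : X → Prop} :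
    (∀ᵐ x ∂(densityMeasure vol q), s x) ↔ ∀ᵐ x ∂vol, q x ≠ 0 → s x := by
  rw [densityMeasure, ae_withDensity_iff hq.ennreal_ofReal]
  have (x : X) : ENNReal.ofReal (q x) ≠ 0 ↔ q x ≠ 0 := by
    rw [Ne, ENNReal.ofReal_eq_zero, not_le, lt_iff_le_and_ne]
    exact ⟨fun h => h.2.symm, fun h => ⟨h0 x, h.symm⟩⟩
  simp only [this]

lemma lintegral_density_eq_one [IsProbabilityMeasure (densityMeasure vol q)] :
    ∫⁻ x, ENNReal.ofReal (q x) ∂vol = 1 := by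
  rw [← setLIntegral_univ, ← withDensity_apply _ MeasurableSet.univ]
  exact measure_univ (μ := densityMeasure vol q)

/-- A solution of the Schrödinger system for the kernel `K` with respect to reference measures
`volX` and `volY`, whose backward equation is only required where the initial density is
non-zero. -/
structure IsFactorization (K : X → Y → ℝ) (volX : Measure X) (volY : Measure Y)
    (q₀ : X → ℝ) (qT : Y → ℝ) (φ₀ ψ₀ : X → ℝ) (φT ψT : Y → ℝ) : Prop where
  measurable_phi₀ : Measurable φ₀
  measurable_psi₀ : Measurable ψ₀
  measurable_phiT : Measurable φT
  measurable_psiT : Measurable ψT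
  phi₀_nonneg : ∀ x, 0 ≤ φ₀ x
  psi₀_nonneg : ∀ x, 0 ≤ ψ₀ x
  phiT_nonneg : ∀ y, 0 ≤ φT y
  psiT_nonneg : ∀ y, 0 ≤ ψT y
  backward : ∀ᵐ x ∂volX, q₀ x ≠ 0 → Integrable (fun y => K x y * φT y) volY ∧
    φ₀ x = ∫ y, K x y * φT y ∂volY
  forward : ∀ᵐ y ∂volY, Integrable (fun x => K x y * ψ₀ x) volX ∧
    ψT y = ∫ x, K x y * ψ₀ x ∂volX
  initial : ∀ᵐ x ∂volX, q₀ x = φ₀ x * ψ₀ x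
  terminal : ∀ᵐ y ∂volY, qT y = φT y * ψT y

variable {K : X → Y → ℝ} {A : Set X} {B : Set Y} {ε M : ℝ} {volX : Measure X} {volY : Measure Y}
  {q₀ φ₀ ψ₀ : X → ℝ} {qT φT ψT f : Y → ℝ}

/-- The key identity: `ψ₀ ∫ K(·,y) φT(y) dy` is the initial density, also where the backward
equation is not required, since both sides have the same total mass. -/
lemma IsFactorization.psi₀_mul_lintegral [SFinite volX] [SFinite volY]
    (hK : IsPinchedKernel K A B ε M)
    (h : IsFactorization K volX volY q₀ qT φ₀ ψ₀ φT ψT)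
    [IsProbabilityMeasure (densityMeasure volX q₀)]
    [IsProbabilityMeasure (densityMeasure volY qT)] :
    ∀ᵐ x ∂volX, ENNReal.ofReal (q₀ x)
      = ∫⁻ y, ENNReal.ofReal (ψ₀ x * (K x y * φT y)) ∂volY := by
  have hmeas : Measurable fun z : X × Y => ENNReal.ofReal (ψ₀ z.1 * (K z.1 z.2 * φT z.2)) :=
    ((h.measurable_psi₀.comp measurable_fst).mul
      (hK.measurable.mul (h.measurable_phiT.comp measurable_snd))).ennreal_ofReal
  -- By Tonelli and the forward equation this is the mass of `φT * ψT`, that is, of `qT`.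
  have htot : ∫⁻ x, ∫⁻ y, ENNReal.ofReal (ψ₀ x * (K x y * φT y)) ∂volY ∂volX = 1 := by
    rw [lintegral_lintegral_swap hmeas.aemeasurable,
      ← lintegral_density_eq_one (vol := volY) (q := qT)]
    refine lintegral_congr_ae ?_
    filter_upwards [h.forward, h.terminal] with y hy hyT
    rw [hyT, hy.2, ← integral_const_mul, ofReal_integral_eq_lintegral_ofReal (hy.1.const_mul _)
      (Eventually.of_forall fun x => mul_nonneg (h.phiT_nonneg y)
        (mul_nonneg (hK.nonneg x y) (h.psi₀_nonneg x)))]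
    exact lintegral_congr fun x => by ring_nf
  -- The inequality `≤` is trivial where `q₀ = 0` and an equality elsewhere; equal finite masses
  -- then force equality almost everywhere.
  refine ae_eq_of_ae_le_of_lintegral_le ?_ ?_ ?_ ?_
  · filter_upwards [h.backward, h.initial] with x hx hx₀
    by_cases hq : q₀ x = 0
    · simp [hq]
    · obtain ⟨hint, heq⟩ := hx hq
      rw [← ofReal_integral_eq_lintegral_ofReal (hint.const_mul _)
        (Eventually.of_forall fun y => mul_nonneg (h.psi₀_nonneg x)
          (mul_nonneg (hK.nonneg x y) (h.phiT_nonneg y))), integral_const_mul, ← heq, hx₀, mul_comm]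
  · rw [lintegral_density_eq_one]; exact ENNReal.one_ne_top
  · exact hmeas.lintegral_prod_right'.aemeasurable
  · rw [htot, lintegral_density_eq_one]

/-- No mass comparison is needed on this side, since the forward equation holds almost everywhere.
-/
lemma IsFactorization.phiT_mul_lintegral
    (hK : IsPinchedKernel K A B ε M)
    (h : IsFactorization K volX volY q₀ qT φ₀ ψ₀ φT ψT) :
    ∀ᵐ y ∂volY, ENNReal.ofReal (qT y)
      = ∫⁻ x, ENNReal.ofReal (φT y * (K x y * ψ₀ x)) ∂volX := by
  filter_upwards [h.forward, h.terminal] with y hy hyT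
  rw [hyT, hy.2, ← integral_const_mul, ofReal_integral_eq_lintegral_ofReal (hy.1.const_mul _)
    (Eventually.of_forall fun x => mul_nonneg (h.phiT_nonneg y)
      (mul_nonneg (hK.nonneg x y) (h.psi₀_nonneg x)))]

/-- A vanishing integral of a non-negative function: where the density is zero, `ψ` may survive only
at points that the kernel does not connect to the mass of `φ`. -/
lemma ae_eq_zero_of_density_eq_lintegral {φ : Y → ℝ} {ψ : X → ℝ}
    (hK : IsPinchedKernel K A B ε M) (hφ : Measurable φ) (hφ0 : ∀ y, 0 ≤ φ y)
    (hψ0 : ∀ x, 0 ≤ ψ x)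
    (h : ∀ᵐ x ∂volX, ENNReal.ofReal (q₀ x) = ∫⁻ y, ENNReal.ofReal (ψ x * (K x y * φ y)) ∂volY) :
    ∀ᵐ x ∂volX, q₀ x = 0 → ∀ᵐ y ∂volY, ψ x * (K x y * φ y) = 0 := by
  filter_upwards [h] with x hx hq
  have hm : Measurable fun y => ENNReal.ofReal (ψ x * (K x y * φ y)) :=
    ((hK.measurable.of_uncurry_left.mul hφ).const_mul _).ennreal_ofReal
  rw [hq, ENNReal.ofReal_zero, eq_comm, lintegral_eq_zero_iff hm] at hx
  filter_upwards [hx] with y hy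
  exact le_antisymm (by simpa using hy)
    (mul_nonneg (hψ0 x) (mul_nonneg (hK.nonneg x y) (hφ0 y)))

/-- The reduction of an equation of the Schrödinger system to the support of the density. -/
lemma eq_kernelMap_of_density_eq_lintegral [SFinite volX] [SFinite volY]
    {φ ψ : X → ℝ} {φ' ψ' : Y → ℝ}
    (hK : IsPinchedKernel K A B ε M) (hq₀ : Measurable q₀) (hq₀0 : ∀ x, 0 ≤ q₀ x)
    (hφ' : Measurable φ') (hψ : Measurable ψ)
    (hφ'0 : ∀ y, 0 ≤ φ' y) (hψ0 : ∀ x, 0 ≤ ψ x)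
    (h : ∀ᵐ x ∂volX, ENNReal.ofReal (q₀ x) = ∫⁻ y, ENNReal.ofReal (ψ x * (K x y * φ' y)) ∂volY)
    (hi : ∀ᵐ x ∂volX, q₀ x = φ x * ψ x) (ht : ∀ᵐ y ∂volY, qT y = φ' y * ψ' y)
    (he : ∀ᵐ y ∂volY, qT y ≠ 0 → Integrable (fun x => K x y * ψ x) volX ∧
      ψ' y = ∫ x, K x y * ψ x ∂volX) :
    ∀ᵐ y ∂volY, qT y ≠ 0 → Integrable (fun x => K x y * φ⁻¹ x) (densityMeasure volX q₀) ∧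
      ψ' y = kernelMap (flip K) (densityMeasure volX q₀) φ⁻¹ y := by
  have h1 := ae_eq_zero_of_density_eq_lintegral hK hφ' hφ'0 hψ0 h
  have h2 : ∀ᵐ x ∂volX, ∀ᵐ y ∂volY, q₀ x = 0 → ψ x * (K x y * φ' y) = 0 := by
    filter_upwards [h1] with x hx
    by_cases hq : q₀ x = 0
    · filter_upwards [hx hq] with y hy _ using hy
    · exact Eventually.of_forall fun y h => absurd h hq
  -- Exchanging the quantifiers fixes a `y` with `φ' y ≠ 0`; then `K x y * ψ x` vanishes for a.e.
  -- `x` with `q₀ x = 0`, and elsewhere `ψ = q₀ / φ`.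
  rw [Measure.ae_ae_comm] at h2
  · filter_upwards [h2, ht, he] with y h2y hty hey hq
    obtain ⟨hint, heq⟩ := hey hq
    have hφy : φ' y ≠ 0 := fun h0 => hq (by rw [hty, h0, zero_mul])
    have hae : (fun x => K x y * ψ x) =ᵐ[volX] fun x => q₀ x * (K x y * φ⁻¹ x) := by
      filter_upwards [h2y, hi] with x hx hix
      by_cases hqx : q₀ x = 0
      · have := hx hqx
        rw [hqx, zero_mul]
        have h3 : (K x y * ψ x) * φ' y = 0 := by linarith
        exact (mul_eq_zero.1 h3).resolve_right hφy
      · have hφx : φ x ≠ 0 := fun h0 => hqx (by rw [hix, h0, zero_mul])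
        rw [hix, Pi.inv_apply]; field_simp
    refine ⟨(integrable_densityMeasure_iff hq₀ hq₀0).2 (hint.congr hae), ?_⟩
    rw [heq, kernelMap, integral_densityMeasure hq₀ hq₀0]
    exact integral_congr_ae hae
  · have hm : Measurable fun z : X × Y => ψ z.1 * (K z.1 z.2 * φ' z.2) :=
      (hψ.comp measurable_fst).mul (hK.measurable.mul (hφ'.comp measurable_snd))
    have : {z : X × Y | q₀ z.1 = 0 → ψ z.1 * (K z.1 z.2 * φ' z.2) = 0}
        = {z | q₀ z.1 = 0}ᶜ ∪ {z | ψ z.1 * (K z.1 z.2 * φ' z.2) = 0} := by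
      ext z; simp only [Set.mem_ofPred_eq, Set.mem_union, Set.mem_compl_iff, imp_iff_not_or]
    rw [this]
    exact (measurableSet_eq_fun (hq₀.comp measurable_fst) measurable_const).compl.union
      (measurableSet_eq_fun hm measurable_const)

/-- Uniqueness up to scaling for the reduced Schrödinger system. -/
lemma IsFactorization.exists_scaling [SFinite volX] [SFinite volY]
    (hK : IsPinchedKernel K A B ε M)
    (h : IsFactorization K volX volY q₀ qT φ₀ ψ₀ φT ψT)
    (hq₀ : Measurable q₀) (hq₀0 : ∀ x, 0 ≤ q₀ x) (hqT : Measurable qT) (hqT0 : ∀ y, 0 ≤ qT y)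
    [IsProbabilityMeasure (densityMeasure volX q₀)]
    [IsProbabilityMeasure (densityMeasure volY qT)]
    (hA : ∀ᵐ x ∂(densityMeasure volX q₀), x ∈ A) (hB : ∀ᵐ y ∂(densityMeasure volY qT), y ∈ B)
    (hf : IsPositiveOn B f)
    (hfix : step K (densityMeasure volX q₀) (densityMeasure volY qT) f = f) :
    ∃ c : ℝ, 0 < c ∧
      (∀ᵐ x ∂volX, q₀ x ≠ 0 → φ₀ x = c⁻¹ * kernelMap K (densityMeasure volY qT) f⁻¹ x) ∧
      (∀ᵐ y ∂volY, qT y ≠ 0 → ψT y = c * f y) := by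
  set μ := densityMeasure volX q₀
  set ν := densityMeasure volY qT
  have hX := h.psi₀_mul_lintegral hK
  have hY := h.phiT_mul_lintegral hK
  have e1 := eq_kernelMap_of_density_eq_lintegral hK hq₀ hq₀0 h.measurable_phiT
    h.measurable_psi₀ h.phiT_nonneg h.psi₀_nonneg hX h.initial h.terminal
    (h.forward.mono fun y hy _ => hy)
  have e2 := eq_kernelMap_of_density_eq_lintegral hK.swap hqT hqT0 h.measurable_psi₀
    h.measurable_phiT h.psi₀_nonneg h.phiT_nonneg hY
    (h.terminal.mono fun y hy => by rw [hy, mul_comm])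
    (h.initial.mono fun x hx => by rw [hx, mul_comm]) h.backward
  rw [← ae_densityMeasure_iff hq₀ hq₀0] at e2
  rw [← ae_densityMeasure_iff hqT hqT0] at e1
  have hψTpos : ∀ᵐ y ∂ν, 0 < ψT⁻¹ y := by
    rw [ae_densityMeasure_iff hqT hqT0]
    filter_upwards [h.terminal] with y hy hq
    exact inv_pos.2 ((h.psiT_nonneg y).lt_of_ne' fun h0 => hq (by rw [hy, h0, mul_zero]))
  -- One point `x` of `A` with `K x · * ψT⁻¹` integrable suffices, since `K x · ≥ ε` on `B`.
  have hψTint : Integrable ψT⁻¹ ν := by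
    obtain ⟨x, hx, hxA⟩ := (e2.and hA).exists
    refine (hx.1.const_mul ε⁻¹).mono' h.measurable_psiT.inv.aestronglyMeasurable ?_
    filter_upwards [hψTpos, hB] with y hy hyB
    rw [Real.norm_of_nonneg hy.le, le_inv_mul_iff₀ hK.pos]
    exact mul_le_mul_of_nonneg_right (hK.lower x hxA y hyB) hy.le
  have hψTI : 0 < ∫ y, ψT⁻¹ y ∂ν := by
    rw [integral_pos_iff_support_of_nonneg_ae (hψTpos.mono fun y hy => hy.le) hψTint,
      pos_iff_ne_zero]
    intro h0
    obtain ⟨y, hy, hy'⟩ := (hψTpos.and (measure_eq_zero_iff_ae_notMem.1 h0)).exists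
    exact hy' hy.ne'
  have hpos := hK.isPositiveOn_step hA hB h.measurable_psiT hψTint
    (hψTpos.mono fun y hy => hy.le) hψTI
  have hφ₀ : φ₀ =ᵐ[μ] kernelMap K ν ψT⁻¹ := e2.mono fun x hx => hx.2
  -- The two reduced equations together say that `ψT` is fixed `ν`-a.e.; its image under the step is
  -- then an exact fixed point, proportional to `f`.
  have hstep : step K μ ν ψT =ᵐ[ν] ψT := by
    rw [step, ← kernelMap_congr_ae (flip K) (u := φ₀⁻¹) hφ₀.inv]
    exact e1.mono fun y hy => hy.2.symm
  obtain ⟨c, hc, hcf⟩ := eq_smul_of_fixedPoint hK hA hB hf hpos hfix (step_congr_ae K μ hstep)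
  have hψT : ψT =ᵐ[ν] c • f := hcf ▸ hstep.symm
  refine ⟨c, hc, (ae_densityMeasure_iff hq₀ hq₀0).1 ?_, (ae_densityMeasure_iff hqT hqT0).1 hψT⟩
  filter_upwards [hφ₀] with x hx
  rw [hx, kernelMap_congr_ae K hψT.inv, inv_const_smul, kernelMap_const_smul]
  rfl

/-- If the factors vanish off the supports, then they vanish wherever the densities do. -/
lemma ae_psi_eq_zero {φ : Y → ℝ} {ψ : X → ℝ} {ψ' : Y → ℝ}
    (hK : IsPinchedKernel K A B ε M) (hφ : Measurable φ) (hφ0 : ∀ y, 0 ≤ φ y)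
    (hψ0 : ∀ x, 0 ≤ ψ x) (hqT : Measurable qT) (hqT0 : ∀ y, 0 ≤ qT y)
    [IsProbabilityMeasure (densityMeasure volY qT)]
    (hB : ∀ᵐ y ∂(densityMeasure volY qT), y ∈ B)
    (h : ∀ᵐ x ∂volX, ENNReal.ofReal (q₀ x) = ∫⁻ y, ENNReal.ofReal (ψ x * (K x y * φ y)) ∂volY)
    (ht : ∀ᵐ y ∂volY, qT y = φ y * ψ' y) (hoff : ∀ᵐ x ∂volX, x ∉ A → ψ x = 0) :
    ∀ᵐ x ∂volX, q₀ x = 0 → ψ x = 0 := by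
  filter_upwards [ae_eq_zero_of_density_eq_lintegral hK hφ hφ0 hψ0 h, hoff] with x hx hxA hq
  by_contra hψ
  have hA : x ∈ A := by_contra fun hA => hψ (hxA hA)
  -- `φ` is non-zero wherever `qT` is, and the kernel is positive on `A × B`, so a non-zero `ψ x`
  -- would contradict the vanishing product.
  have h1 : ∀ᵐ y ∂(densityMeasure volY qT), ψ x * (K x y * φ y) = 0 ∧ φ y ≠ 0 := by
    rw [ae_densityMeasure_iff hqT hqT0]
    filter_upwards [hx hq, ht] with y hy hty hqy
    exact ⟨hy, fun h0 => hqy (by rw [hty, h0, zero_mul])⟩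
  obtain ⟨y, ⟨hy, hφy⟩, hyB⟩ := (h1.and hB).exists
  exact mul_ne_zero hψ (mul_ne_zero (hK.pos.trans_le (hK.lower x hA y hyB)).ne' hφy) hy

/-- Uniqueness up to scaling, almost everywhere, for factors that vanish off the supports. -/
lemma IsFactorization.eq_of_vanish [SFinite volX] [SFinite volY]
    (hK : IsPinchedKernel K A B ε M)
    (h : IsFactorization K volX volY q₀ qT φ₀ ψ₀ φT ψT)
    (hq₀ : Measurable q₀) (hq₀0 : ∀ x, 0 ≤ q₀ x) (hqT : Measurable qT) (hqT0 : ∀ y, 0 ≤ qT y)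
    [IsProbabilityMeasure (densityMeasure volX q₀)]
    [IsProbabilityMeasure (densityMeasure volY qT)]
    (hA : ∀ᵐ x ∂(densityMeasure volX q₀), x ∈ A) (hB : ∀ᵐ y ∂(densityMeasure volY qT), y ∈ B)
    (hfix : step K (densityMeasure volX q₀) (densityMeasure volY qT) f = f)
    {c : ℝ}
    (hφ₀ : ∀ᵐ x ∂volX, q₀ x ≠ 0 → φ₀ x = c⁻¹ * kernelMap K (densityMeasure volY qT) f⁻¹ x)
    (hψT : ∀ᵐ y ∂volY, qT y ≠ 0 → ψT y = c * f y)
    (hoffX : ∀ᵐ x ∂volX, x ∉ A → ψ₀ x = 0) (hoffY : ∀ᵐ y ∂volY, y ∉ B → φT y = 0) :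
    (∀ᵐ x ∂volX, ψ₀ x = c * (q₀ x / kernelMap K (densityMeasure volY qT) f⁻¹ x)) ∧
    (∀ᵐ y ∂volY, φT y = c⁻¹ * (qT y / f y)) ∧ (∀ᵐ y ∂volY, ψT y = c * f y) ∧
    (∀ x, φ₀ x = ∫ y, K x y * φT y ∂volY →
      φ₀ x = c⁻¹ * kernelMap K (densityMeasure volY qT) f⁻¹ x) := by
  have hX := ae_psi_eq_zero hK h.measurable_phiT h.phiT_nonneg h.psi₀_nonneg hqT hqT0 hB
    (h.psi₀_mul_lintegral hK) h.terminal hoffX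
  have hY := ae_psi_eq_zero hK.swap h.measurable_psi₀ h.psi₀_nonneg h.phiT_nonneg hq₀ hq₀0 hA
    (h.phiT_mul_lintegral hK) (h.initial.mono fun x hx => by rw [hx, mul_comm]) hoffY
  have e1 : ∀ᵐ x ∂volX, ψ₀ x = c * (q₀ x / kernelMap K (densityMeasure volY qT) f⁻¹ x) := by
    filter_upwards [hX, h.initial, hφ₀] with x hx hi hφ
    by_cases hq : q₀ x = 0
    · rw [hx hq, hq, zero_div, mul_zero]
    · have hne : φ₀ x ≠ 0 := fun h0 => hq (by rw [hi, h0, zero_mul])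
      rw [hφ hq] at hi hne
      have h1 := right_ne_zero_of_mul hne
      have h2 : c ≠ 0 := fun h0 => left_ne_zero_of_mul hne (by simp [h0])
      rw [hi]; field_simp
  have e2 : ∀ᵐ y ∂volY, φT y = c⁻¹ * (qT y / f y) := by
    filter_upwards [hY, h.terminal, hψT] with y hy ht hψ
    by_cases hq : qT y = 0
    · rw [hy hq, hq, zero_div, mul_zero]
    · have hne : ψT y ≠ 0 := fun h0 => hq (by rw [ht, h0, mul_zero])
      rw [hψ hq] at ht hne
      have h1 := right_ne_zero_of_mul hne
      have h2 := left_ne_zero_of_mul hne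
      rw [ht]; field_simp
  refine ⟨e1, e2, ?_, fun x hx => ?_⟩
  -- With `ψ₀` known almost everywhere, the forward equation gives `ψT` also off the support of
  -- `qT`.
  · filter_upwards [h.forward] with y hy
    rw [hy.2, ← congrFun hfix y, step, kernelMap, integral_densityMeasure hq₀ hq₀0,
      ← integral_const_mul]
    refine integral_congr_ae (e1.mono fun x hx => ?_)
    simp only [hx, flip, Pi.inv_apply]; ring
  · rw [hx, kernelMap, integral_densityMeasure hqT hqT0, ← integral_const_mul]
    refine integral_congr_ae (e2.mono fun y hy => ?_)
    simp only [hy, Pi.inv_apply]; ring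

end Density

/-! ### Merging the regimes into one state space. -/

section Hybrid

variable {d m : ℕ}

/-- Lebesgue measure in each regime, as a measure on the hybrid state space. -/
def hybridVolume (d m : ℕ) : Measure (State d m) :=
  Measure.sum fun j : Fin m => (volume : Measure (Space d)).map fun x => (x, j)

instance : SFinite (hybridVolume d m) := by
  unfold hybridVolume; infer_instance

/-- The subset of the hybrid state space with the slices `A j`. -/
def hybridSet (A : Fin m → Set (Space d)) : Set (State d m) := {z | z.1 ∈ A z.2}

/-- The kernel on the hybrid state space given by the kernels between the regimes. -/
def hybridKernel (P : Fin m → Fin m → Space d → Space d → ℝ) : State d m → State d m → ℝ :=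
  fun z w => P z.2 w.2 z.1 w.1

lemma measurable_uncurry_of_forall {f : Space d → Fin m → ℝ}
    (hf : ∀ j, Measurable fun y => f y j) : Measurable (Function.uncurry f) :=
  measurable_from_prod_countable_left hf

lemma measurableSet_hybridSet {A : Fin m → Set (Space d)} (hA : ∀ j, MeasurableSet (A j)) :
    MeasurableSet (hybridSet A) := by
  have : hybridSet A = ⋃ j, A j ×ˢ {j} := by
    ext z
    simp [hybridSet]
  rw [this]
  exact MeasurableSet.iUnion fun j => (hA j).prod (measurableSet_singleton j)

lemma ae_hybridVolume_iff {s : State d m → Prop} :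
    (∀ᵐ z ∂(hybridVolume d m), s z) ↔ ∀ j, ∀ᵐ x, s (x, j) := by
  simp only [hybridVolume, Measure.ae_sum_iff, (measurableEmbedding_prod_mk_right _).ae_map_iff]

lemma integrable_hybridVolume_iff {g : State d m → ℝ} :
    Integrable g (hybridVolume d m) ↔ ∀ j, Integrable fun x => g (x, j) := by
  rw [hybridVolume, Measure.sum_fintype, integrable_finsetSum_measure]
  simp only [Finset.mem_univ, forall_const,
    (measurableEmbedding_prod_mk_right _).integrable_map_iff, Function.comp_def]

lemma integral_hybridVolume {g : State d m → ℝ} (hg : Integrable g (hybridVolume d m)) :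
    ∫ z, g z ∂(hybridVolume d m) = ∑ j, ∫ x, g (x, j) := by
  rw [hybridVolume, integral_sum_measure hg, tsum_fintype]
  simp only [(measurableEmbedding_prod_mk_right _).integral_map]

/-- A measurable set is the disjoint union of its finitely many regime slices. This identity carries
the abstract results over to `ρ₀` and `ρT`. -/
lemma HasDensities.eq_densityMeasure {μ : Measure (State d m)} {q : Space d → Fin m → ℝ}
    (h : HasDensities μ q) : μ = densityMeasure (hybridVolume d m) (Function.uncurry q) := by
  ext s hs
  have hs' (j : Fin m) : MeasurableSet {x | (x, j) ∈ s} :=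
    (measurableEmbedding_prod_mk_right j).measurable hs
  have hU : s = ⋃ j, {x | (x, j) ∈ s} ×ˢ {j} := by
    ext z
    simp
  have hdisj : Pairwise (Function.onFun Disjoint
      fun j : Fin m => {x | (x, j) ∈ s} ×ˢ ({j} : Set (Fin m))) := fun i j hij =>
    Set.disjoint_left.2 fun z hz hz' => hij (by
      rw [← Set.mem_singleton_iff.1 hz.2, ← Set.mem_singleton_iff.1 hz'.2])
  conv_lhs => rw [hU, measure_iUnion hdisj fun j => (hs' j).prod (measurableSet_singleton j)]
  rw [densityMeasure, withDensity_apply _ hs, ← lintegral_indicator hs, hybridVolume,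
    lintegral_sum_measure]
  refine tsum_congr fun j => ?_
  rw [h.measure_eq j _ (hs' j), (measurableEmbedding_prod_mk_right j).lintegral_map,
    ← lintegral_indicator (hs' j)]
  rfl

/-- There are finitely many regimes, so the lower bounds of the slices have a positive minimum. -/
lemma isAdmissible_iff [NeZero m] {A : Fin m → Set (Space d)} {f : Space d → Fin m → ℝ} :
    IsAdmissible A f ↔ IsPositiveOn (hybridSet A) (Function.uncurry f) := by
  constructor
  · intro h
    obtain ⟨C, hC⟩ := h.bounded
    choose c hc hcf using h.lower
    obtain ⟨j₀, hj₀⟩ := Finite.exists_min c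
    exact ⟨measurable_uncurry_of_forall h.measurable, fun z => h.nonneg _ _,
      ⟨C, fun z => hC _ _⟩, ⟨c j₀, hc j₀, fun z hz => (hj₀ z.2).trans (hcf z.2 z.1 hz)⟩⟩
  · intro h
    obtain ⟨C, hC⟩ := h.bounded
    obtain ⟨c, hc, hcf⟩ := h.lower
    exact ⟨fun j => h.measurable.comp (measurableEmbedding_prod_mk_right j).measurable,
      fun y j => h.nonneg (y, j), ⟨C, fun y j => hC (y, j)⟩,
      fun j => ⟨c, hc, fun y hy => hcf (y, j) hy⟩⟩

lemma uncurry_invMap (f : Space d → Fin m → ℝ) :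
    Function.uncurry (invMap f) = (Function.uncurry f)⁻¹ := by
  funext z
  simp [Function.uncurry, invMap]

/-! ### The norm on the supports. -/

section Norm

variable {A : Fin m → Set (Space d)} {f g : Space d → Fin m → ℝ}

/-- Pointwise bounds pass to the norm; homogeneity, the bounds on the normalizing constants and norm
convergence all rest on this. -/
lemma suppNorm_le_mul {c : ℝ}
    (h : ∀ j, ∀ᵐ y ∂(volume.restrict (A j)), |f y j| ≤ c * |g y j|) :
    suppNorm A f ≤ ENNReal.ofReal c * suppNorm A g := by
  have h1 : ∑ j, eLpNorm (fun y => f y j) 2 (volume.restrict (A j)) ^ 2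
      ≤ ENNReal.ofReal c ^ 2 * ∑ j, eLpNorm (fun y => g y j) 2 (volume.restrict (A j)) ^ 2 := by
    rw [Finset.mul_sum]
    refine Finset.sum_le_sum fun j _ => ?_
    rw [← mul_pow]
    gcongr
    exact eLpNorm_le_mul_eLpNorm_of_ae_le_mul (h j) 2
  calc suppNorm A f
      ≤ (ENNReal.ofReal c ^ 2 *
          ∑ j, eLpNorm (fun y => g y j) 2 (volume.restrict (A j)) ^ 2) ^ (1 / 2 : ℝ) :=
        ENNReal.rpow_le_rpow h1 (by norm_num)
    _ = ENNReal.ofReal c * suppNorm A g := by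
        rw [ENNReal.mul_rpow_of_nonneg _ _ (by norm_num), ← ENNReal.rpow_natCast,
          ← ENNReal.rpow_mul]
        norm_num [suppNorm]

lemma suppNorm_const_smul {c : ℝ} (hc : 0 < c) (f : Space d → Fin m → ℝ) :
    suppNorm A (c • f) = ENNReal.ofReal c * suppNorm A f := by
  refine le_antisymm (suppNorm_le_mul fun j => Eventually.of_forall fun y => ?_) ?_
  · simp [abs_mul, abs_of_pos hc]
  · have h : suppNorm A f ≤ ENNReal.ofReal c⁻¹ * suppNorm A (c • f) :=
      suppNorm_le_mul fun j => Eventually.of_forall fun y => by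
        simp [abs_mul, abs_of_pos hc, hc.ne']
    calc ENNReal.ofReal c * suppNorm A f
        ≤ ENNReal.ofReal c * (ENNReal.ofReal c⁻¹ * suppNorm A (c • f)) := by gcongr
      _ = suppNorm A (c • f) := by
        rw [← mul_assoc, ← ENNReal.ofReal_mul hc.le, mul_inv_cancel₀ hc.ne', ENNReal.ofReal_one,
          one_mul]

lemma suppNorm_congr_ae (h : ∀ j, ∀ᵐ y ∂(volume.restrict (A j)), f y j = g y j) :
    suppNorm A f = suppNorm A g := by
  simp only [suppNorm]
  congr 1
  exact Finset.sum_congr rfl fun j _ => by rw [eLpNorm_congr_ae (h j)]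

lemma IsAdmissible.suppNorm_ne_top (hA : ∀ j, IsCompact (A j)) (hf : IsAdmissible A f) :
    suppNorm A f ≠ ∞ := by
  obtain ⟨C, hC⟩ := hf.bounded
  refine ENNReal.rpow_ne_top_of_nonneg (by norm_num) ?_
  refine (ENNReal.sum_lt_top.2 fun j _ => ENNReal.pow_lt_top ?_).ne
  have : IsFiniteMeasure (volume.restrict (A j)) :=
    isFiniteMeasure_restrict.2 (hA j).measure_lt_top.ne
  refine (MemLp.of_bound (hf.measurable j).aestronglyMeasurable C
    (Eventually.of_forall fun y => ?_)).eLpNorm_lt_top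
  rw [Real.norm_of_nonneg (hf.nonneg y j)]
  exact hC y j

lemma ae_eq_zero_of_suppNorm_eq_zero (hf : ∀ j, Measurable fun y => f y j)
    (h : suppNorm A f = 0) (j : Fin m) : ∀ᵐ y ∂(volume.restrict (A j)), f y j = 0 := by
  rw [suppNorm, ENNReal.rpow_eq_zero_iff_of_pos (by norm_num), Finset.sum_eq_zero_iff] at h
  have := (pow_eq_zero_iff two_ne_zero).1 (h j (Finset.mem_univ j))
  exact (eLpNorm_eq_zero_iff (hf j).aestronglyMeasurable two_ne_zero).1 this

end Norm

/-! ### The Sinkhorn map as an abstract step, and existence of the fixed point. -/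

/-- The data of the Schrödinger problem, with quantitative bounds for the kernel. -/
structure SchrodingerData (P : Fin m → Fin m → Space d → Space d → ℝ)
    (ρ₀ ρT : Measure (State d m)) (q₀ qT : Space d → Fin m → ℝ) (ε M : ℝ) : Prop where
  kernel : IsPinchedKernel (hybridKernel P) (hybridSet (supp q₀)) (hybridSet (supp qT)) ε M
  initial : HasDensities ρ₀ q₀
  terminal : HasDensities ρT qT
  compact : ∀ j, IsCompact (supp qT j)

variable {P : Fin m → Fin m → Space d → Space d → ℝ} {ρ₀ ρT : Measure (State d m)}
  {q₀ qT q : Space d → Fin m → ℝ} {ε M : ℝ}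

lemma HasDensities.ae_iff {μ : Measure (State d m)} (h : HasDensities μ q)
    {s : State d m → Prop} :
    (∀ᵐ z ∂μ, s z) ↔ ∀ᵐ z ∂(hybridVolume d m), Function.uncurry q z ≠ 0 → s z := by
  conv_lhs => rw [h.eq_densityMeasure]
  exact ae_densityMeasure_iff (measurable_uncurry_of_forall h.measurable) fun z => h.nonneg _ _

lemma measurableSet_supp (q : Space d → Fin m → ℝ) (j : Fin m) : MeasurableSet (supp q j) :=
  (isClosed_tsupport _).measurableSet

lemma HasDensities.ae_mem_supp {μ : Measure (State d m)} (h : HasDensities μ q) :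
    ∀ᵐ z ∂μ, z ∈ hybridSet (supp q) :=
  h.ae_iff.2 <| Eventually.of_forall fun z hz =>
    subset_tsupport (fun x => q x z.2) (Function.mem_support.2 hz)

lemma HasDensities.ae_of_ae_restrict {μ : Measure (State d m)} (h : HasDensities μ q)
    {s : Space d → Fin m → Prop} (hs : ∀ j, ∀ᵐ y ∂(volume.restrict (supp q j)), s y j) :
    ∀ᵐ z ∂μ, s z.1 z.2 := by
  have h1 : ∀ᵐ z ∂(hybridVolume d m), z ∈ hybridSet (supp q) → s z.1 z.2 :=
    ae_hybridVolume_iff.2 fun j => (ae_restrict_iff' (measurableSet_supp q j)).1 (hs j)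
  filter_upwards [h.ae_iff.2 (h1.mono fun z hz _ => hz), h.ae_mem_supp] with z hz hz'
  exact hz hz'

lemma HasDensities.suppNorm_ne_zero {μ : Measure (State d m)} [NeZero μ] (h : HasDensities μ q)
    {f : Space d → Fin m → ℝ} (hm : ∀ j, Measurable fun y => f y j)
    (hf : ∀ j, ∀ᵐ y ∂(volume.restrict (supp q j)), 0 < f y j) : suppNorm (supp q) f ≠ 0 := by
  intro h0
  have h1 : ∀ᵐ z ∂μ, False := (h.ae_of_ae_restrict (s := fun _ _ => False) fun j => by
    filter_upwards [hf j, ae_eq_zero_of_suppNorm_eq_zero hm h0 j] with y hy hy'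
    exact hy.ne' hy')
  exact NeZero.ne μ (ae_eq_bot.1 (eventually_false_iff_eq_bot.1 h1))

lemma HasDensities.sum_integral_eq {μ : Measure (State d m)} (h : HasDensities μ q)
    {u : State d m → ℝ} (hu : Integrable u μ) :
    ∑ j, ∫ y, q y j * u (y, j) = ∫ z, u z ∂μ := by
  have hm := measurable_uncurry_of_forall h.measurable
  rw [h.eq_densityMeasure, integrable_densityMeasure_iff hm fun z => h.nonneg _ _] at hu
  conv_rhs => rw [h.eq_densityMeasure, integral_densityMeasure hm fun z => h.nonneg _ _,
    integral_hybridVolume hu]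
  rfl

namespace SchrodingerData

variable (D : SchrodingerData P ρ₀ ρT q₀ qT ε M)
include D

lemma uncurry_backwardMap {u : Space d → Fin m → ℝ} (hu : Integrable (Function.uncurry u) ρT) :
    Function.uncurry (backwardMap P qT u) = kernelMap (hybridKernel P) ρT (Function.uncurry u) := by
  funext ⟨x, i⟩
  rw [kernelMap, ← D.terminal.sum_integral_eq (D.kernel.integrable_mul hu (x, i))]
  simp only [Function.uncurry, backwardMap, hybridKernel]
  exact Finset.sum_congr rfl fun j _ => integral_congr_ae <| Eventually.of_forall fun y => by ring

lemma uncurry_forwardMap {u : Space d → Fin m → ℝ} (hu : Integrable (Function.uncurry u) ρ₀) :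
    Function.uncurry (forwardMap P q₀ u)
      = kernelMap (flip (hybridKernel P)) ρ₀ (Function.uncurry u) := by
  funext ⟨y, j⟩
  rw [kernelMap, ← D.initial.sum_integral_eq (D.kernel.swap.integrable_mul hu (y, j))]
  simp only [Function.uncurry, forwardMap, hybridKernel, flip]
  exact Finset.sum_congr rfl fun i _ => integral_congr_ae <| Eventually.of_forall fun x => by ring

variable [IsProbabilityMeasure ρ₀] [IsProbabilityMeasure ρT]

/-- Integrability matters here: the Sinkhorn map adds separate integrals over the regimes, which
agree with one integral over the hybrid space only if no default value intervenes. -/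
lemma uncurry_sinkhorn {f : Space d → Fin m → ℝ} (hm : ∀ j, Measurable fun y => f y j)
    (hi : Integrable (Function.uncurry f)⁻¹ ρT) (h0 : 0 ≤ᵐ[ρT] (Function.uncurry f)⁻¹)
    (hI : 0 < ∫ z, (Function.uncurry f)⁻¹ z ∂ρT) :
    Function.uncurry (sinkhorn P q₀ qT f)
      = step (hybridKernel P) ρ₀ ρT (Function.uncurry f) := by
  have hpos := D.kernel.isPositiveOn_kernelMap D.terminal.ae_mem_supp
    (measurable_uncurry_of_forall hm).inv hi h0 hI
  have hb : Function.uncurry (invMap (backwardMap P qT (invMap f)))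
      = (kernelMap (hybridKernel P) ρT (Function.uncurry f)⁻¹)⁻¹ := by
    rw [uncurry_invMap, D.uncurry_backwardMap (by rwa [uncurry_invMap]), uncurry_invMap]
  rw [sinkhorn, D.uncurry_forwardMap, hb, step]
  rw [hb]
  exact hpos.integrable_inv D.initial.ae_mem_supp

variable [NeZero m]

lemma uncurry_sinkhorn_of_isAdmissible {f : Space d → Fin m → ℝ}
    (hf : IsAdmissible (supp qT) f) :
    Function.uncurry (sinkhorn P q₀ qT f)
      = step (hybridKernel P) ρ₀ ρT (Function.uncurry f) := by
  have h := isAdmissible_iff.1 hf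
  exact D.uncurry_sinkhorn hf.measurable (h.integrable_inv D.terminal.ae_mem_supp)
    (Eventually.of_forall h.inv_nonneg) (h.integral_inv_pos D.terminal.ae_mem_supp)

lemma isAdmissible_sinkhorn {f : Space d → Fin m → ℝ} (hf : IsAdmissible (supp qT) f) :
    IsAdmissible (supp qT) (sinkhorn P q₀ qT f) := by
  rw [isAdmissible_iff, D.uncurry_sinkhorn_of_isAdmissible hf]
  exact (isAdmissible_iff.1 hf).step D.kernel D.initial.ae_mem_supp D.terminal.ae_mem_supp

lemma isAdmissible_iterate_sinkhorn {f : Space d → Fin m → ℝ} (hf : IsAdmissible (supp qT) f)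
    (k : ℕ) : IsAdmissible (supp qT) ((sinkhorn P q₀ qT)^[k] f) ∧
      Function.uncurry ((sinkhorn P q₀ qT)^[k] f)
        = (step (hybridKernel P) ρ₀ ρT)^[k] (Function.uncurry f) := by
  induction k with
  | zero => exact ⟨hf, rfl⟩
  | succ k ih =>
    rw [Function.iterate_succ_apply', Function.iterate_succ_apply',
      D.uncurry_sinkhorn_of_isAdmissible ih.1, ih.2]
    exact ⟨D.isAdmissible_sinkhorn ih.1, rfl⟩

omit [IsProbabilityMeasure ρ₀] in
lemma suppNorm_ne_zero {f : Space d → Fin m → ℝ} (hf : IsAdmissible (supp qT) f) :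
    suppNorm (supp qT) f ≠ 0 :=
  D.terminal.suppNorm_ne_zero hf.measurable fun j => by
    rw [ae_restrict_iff' (measurableSet_supp qT j)]
    exact Eventually.of_forall fun y hy => (isAdmissible_iff.1 hf).pos (y := (y, j)) hy

/-- Existence of a normalized fixed point. -/
lemma exists_fixedPoint : ∃ f : Space d → Fin m → ℝ,
    IsAdmissible (supp qT) f ∧ sinkhorn P q₀ qT f = f ∧ suppNorm (supp qT) f = 1 := by
  have h1 : IsPositiveOn (hybridSet (supp qT)) (1 : State d m → ℝ) :=
    ⟨measurable_const, fun _ => zero_le_one, ⟨1, fun _ => le_rfl⟩,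
      ⟨1, one_pos, fun _ _ => le_rfl⟩⟩
  obtain ⟨F, hF, hfix, -⟩ := exists_fixedPoint_of_iterate D.kernel
    (measurableSet_hybridSet (measurableSet_supp qT)) D.initial.ae_mem_supp
    D.terminal.ae_mem_supp h1
  have hadm : IsAdmissible (supp qT) (Function.curry F) := isAdmissible_iff.2 hF
  have hne := D.suppNorm_ne_zero hadm
  have htop := hadm.suppNorm_ne_top D.compact
  set c := (suppNorm (supp qT) (Function.curry F)).toReal
  have hc : 0 < c := ENNReal.toReal_pos hne htop
  have hadm' : IsAdmissible (supp qT) (c⁻¹ • Function.curry F) :=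
    isAdmissible_iff.2 (hF.const_smul (inv_pos.2 hc))
  refine ⟨c⁻¹ • Function.curry F, hadm', ?_, ?_⟩
  · have key : Function.uncurry (sinkhorn P q₀ qT (c⁻¹ • Function.curry F)) = c⁻¹ • F := by
      rw [D.uncurry_sinkhorn_of_isAdmissible hadm']
      exact (step_const_smul _ _ _ c⁻¹ F).trans (by rw [hfix])
    exact congrArg Function.curry key
  · rw [suppNorm_const_smul (inv_pos.2 hc), ENNReal.ofReal_inv_of_pos hc,
      ENNReal.ofReal_toReal htop, ENNReal.inv_mul_cancel hne htop]

end SchrodingerData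

end Hybrid

/-! ### Uniqueness without integrability assumptions, convergence, and the Schrödinger system. -/

/-- The bounds for the kernel map at points of `A` do not require integrability: if `u` is not
integrable, then neither is `K x · * u`, and both integrals are zero. -/
lemma IsPinchedKernel.kernelMap_bounds {X Y : Type*} [MeasurableSpace X] [MeasurableSpace Y]
    {K : X → Y → ℝ} {A : Set X} {B : Set Y} {ε M : ℝ} {ν : Measure Y} {u : Y → ℝ}
    (hK : IsPinchedKernel K A B ε M) (hB : ∀ᵐ y ∂ν, y ∈ B) (hm : Measurable u)
    (h0 : 0 ≤ᵐ[ν] u) {x : X} (hx : x ∈ A) :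
    ε * ∫ y, u y ∂ν ≤ kernelMap K ν u x ∧ kernelMap K ν u x ≤ M * ∫ y, u y ∂ν := by
  by_cases hu : Integrable u ν
  · exact ⟨hK.le_kernelMap hB hu h0 hx, hK.kernelMap_le hu h0 x⟩
  · have hKu : ¬ Integrable (fun y => K x y * u y) ν := fun h => hu <| by
      refine (h.const_mul ε⁻¹).mono' hm.aestronglyMeasurable ?_
      filter_upwards [h0, hB] with y hy hyB
      rw [Real.norm_of_nonneg hy, le_inv_mul_iff₀ hK.pos]
      exact mul_le_mul_of_nonneg_right (hK.lower x hx y hyB) hy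
    rw [kernelMap, integral_undef hu, integral_undef hKu]
    simp

/-- The logarithm of supremum over infimum is squeezed between `0` and `2 * η k`. -/
lemma tendsto_iSup_div_iInf {ι : Type*} [Nonempty ι] {w : ℕ → ι → ℝ} {η : ℕ → ℝ}
    (hη : Tendsto η atTop (𝓝 0))
    (h : ∀ k i, Real.exp (-η k) ≤ w k i ∧ w k i ≤ Real.exp (η k)) :
    Tendsto (fun k => Real.log ((⨆ i, w k i) / ⨅ i, w k i)) atTop (𝓝 0) := by
  have hbdd (k : ℕ) : BddAbove (Set.range (w k)) :=
    ⟨_, Set.forall_mem_range.2 fun i => (h k i).2⟩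
  have hbdd' (k : ℕ) : BddBelow (Set.range (w k)) :=
    ⟨_, Set.forall_mem_range.2 fun i => (h k i).1⟩
  have hinf (k : ℕ) : Real.exp (-η k) ≤ ⨅ i, w k i := le_ciInf fun i => (h k i).1
  have hsup (k : ℕ) : ⨆ i, w k i ≤ Real.exp (η k) := ciSup_le fun i => (h k i).2
  have hpos (k : ℕ) : 0 < ⨅ i, w k i := (Real.exp_pos _).trans_le (hinf k)
  have hle (k : ℕ) : ⨅ i, w k i ≤ ⨆ i, w k i :=
    (ciInf_le (hbdd' k) (Classical.arbitrary ι)).trans (le_ciSup (hbdd k) _)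
  refine squeeze_zero (fun k => Real.log_nonneg ((one_le_div (hpos k)).2 (hle k)))
    (fun k => ?_) (by simpa using hη.add hη)
  rw [Real.log_div ((hpos k).trans_le (hle k)).ne' (hpos k).ne']
  have h1 := Real.log_le_log ((hpos k).trans_le (hle k)) (hsup k)
  have h2 := Real.log_le_log (Real.exp_pos _) (hinf k)
  rw [Real.log_exp] at h1 h2
  linarith

namespace SchrodingerData

variable {d m : ℕ} [NeZero m]
  {P : Fin m → Fin m → Space d → Space d → ℝ} {ρ₀ ρT : Measure (State d m)}
  {q₀ qT : Space d → Fin m → ℝ} {ε M : ℝ} {f : Space d → Fin m → ℝ}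
  [IsProbabilityMeasure ρ₀] [IsProbabilityMeasure ρT]

omit [NeZero m] [IsProbabilityMeasure ρ₀] [IsProbabilityMeasure ρT] in
lemma regime_kernel (D : SchrodingerData P ρ₀ ρT q₀ qT ε M) (i j : Fin m) :
    IsPinchedKernel (P i j) (supp q₀ i) (supp qT j) ε M where
  measurable := D.kernel.measurable.comp (f := fun z : Space d × Space d => ((z.1, i), (z.2, j)))
    ((measurableEmbedding_prod_mk_right i).measurable.prodMap
      (measurableEmbedding_prod_mk_right j).measurable)
  pos := D.kernel.pos
  eps_le := D.kernel.eps_le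
  nonneg x y := D.kernel.nonneg (x, i) (y, j)
  le x y := D.kernel.le (x, i) (y, j)
  lower x hx y hy := D.kernel.lower (x, i) hx (y, j) hy

omit [NeZero m] in
/-- An almost everywhere positive fixed point has an integrable inverse. -/
lemma inv_of_fixedPoint (D : SchrodingerData P ρ₀ ρT q₀ qT ε M) {g : Space d → Fin m → ℝ}
    (hm : ∀ j, Measurable fun y => g y j)
    (hpos : ∀ j, ∀ᵐ y ∂(volume.restrict (supp qT j)), 0 < g y j)
    (hfix : ∀ j, ∀ᵐ y ∂(volume.restrict (supp qT j)), sinkhorn P q₀ qT g y j = g y j) :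
    Integrable (Function.uncurry g)⁻¹ ρT ∧ 0 ≤ᵐ[ρT] (Function.uncurry g)⁻¹ ∧
      0 < ∫ z, (Function.uncurry g)⁻¹ z ∂ρT := by
  have hgpos : ∀ᵐ z ∂ρT, 0 < (Function.uncurry g)⁻¹ z :=
    (D.terminal.ae_of_ae_restrict hpos).mono fun z hz => inv_pos.2 hz
  -- The regimes are treated separately because `1 / g` might be integrable in some and not in
  -- others; the bounds of `kernelMap_bounds` include default values and can be summed.
  let ν : Fin m → Measure (Space d) := fun j => densityMeasure volume fun y => qT y j
  have hν {s : Fin m → Space d → Prop} {j : Fin m} :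
      (∀ᵐ y ∂(ν j), s j y) ↔ ∀ᵐ y, qT y j ≠ 0 → s j y :=
    ae_densityMeasure_iff (D.terminal.measurable j) fun y => D.terminal.nonneg y j
  have hνB (j : Fin m) : ∀ᵐ y ∂(ν j), y ∈ supp qT j :=
    (hν (s := fun j y => y ∈ supp qT j)).2 <| Eventually.of_forall fun y hy =>
      subset_tsupport (fun x => qT x j) (Function.mem_support.2 hy)
  have hνpos (j : Fin m) : ∀ᵐ y ∂(ν j), 0 ≤ invMap g y j := by
    refine (hν (s := fun j y => 0 ≤ invMap g y j)).2 ?_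
    filter_upwards [(ae_restrict_iff' (measurableSet_supp qT j)).1 (hpos j)] with y hy hq
    exact one_div_nonneg.2
      (hy (subset_tsupport (fun x => qT x j) (Function.mem_support.2 hq))).le
  have him (j : Fin m) : Measurable fun y => invMap g y j := (hm j).const_div 1
  set h := backwardMap P qT (invMap g) with hdef
  have hsum (x : Space d) (i : Fin m) :
      h x i = ∑ j, kernelMap (P i j) (ν j) (fun y => invMap g y j) x := by
    simp only [hdef, backwardMap, kernelMap, ν]
    refine Finset.sum_congr rfl fun j _ => ?_
    rw [integral_densityMeasure (D.terminal.measurable j) fun y => D.terminal.nonneg y j]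
    exact integral_congr_ae <| Eventually.of_forall fun y => by ring
  have hhm : Measurable (Function.uncurry h) := measurable_uncurry_of_forall fun i => by
    simp only [hsum]
    exact Finset.measurable_sum _ fun j _ =>
      (D.regime_kernel i j).measurable_kernelMap (him j)
  set a := ∑ j, ∫ y, invMap g y j ∂(ν j)
  have hlow {x : Space d} {i : Fin m} (hx : x ∈ supp q₀ i) : ε * a ≤ h x i := by
    rw [hsum, Finset.mul_sum]
    exact Finset.sum_le_sum fun j _ =>
      ((D.regime_kernel i j).kernelMap_bounds (hνB j) (him j) (hνpos j) hx).1
  have hupp {x : Space d} {i : Fin m} (hx : x ∈ supp q₀ i) : h x i ≤ M * a := by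
    rw [hsum, Finset.mul_sum]
    exact Finset.sum_le_sum fun j _ =>
      ((D.regime_kernel i j).kernelMap_bounds (hνB j) (him j) (hνpos j) hx).2
  have ha0 : 0 ≤ a := Finset.sum_nonneg fun j _ => integral_nonneg_of_ae (hνpos j)
  -- If `a = 0`, then `h` vanishes on the supports of `q₀`, the convention `1 / 0 = 0` makes the
  -- Sinkhorn image zero, and this contradicts `C g = g > 0`.
  have ha : 0 < a := by
    refine ha0.lt_of_ne' fun ha => ?_
    have hzero : ∀ y j, sinkhorn P q₀ qT g y j = 0 := fun y j => by
      rw [sinkhorn, forwardMap]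
      refine Finset.sum_eq_zero fun i _ => ?_
      rw [← integral_zero (Space d) ℝ]
      refine integral_congr_ae <| Eventually.of_forall fun x => ?_
      by_cases hx : x ∈ supp q₀ i
      · have h1 := hlow hx
        have h2 := hupp hx
        rw [ha, mul_zero] at h1 h2
        simp only [← hdef, invMap, le_antisymm h2 h1, div_zero, mul_zero]
      · have : q₀ x i = 0 := image_eq_zero_of_notMem_tsupport (f := fun x => q₀ x i) hx
        simp only [this, mul_zero, zero_mul]
    obtain ⟨z, hz, hz'⟩ := ((D.terminal.ae_of_ae_restrict hpos).and
      (D.terminal.ae_of_ae_restrict hfix)).exists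
    exact hz.ne' (by rw [← hz', hzero])
  have hM : 0 < M := D.kernel.pos.trans_le D.kernel.eps_le
  have hA := measurableSet_hybridSet (measurableSet_supp q₀)
  -- The bounds on `h` are available only on the supports of `q₀`; cutting off there changes nothing
  -- `ρ₀`-a.e.
  have hh' : IsPositiveOn (hybridSet (supp q₀))
      ((hybridSet (supp q₀)).indicator (Function.uncurry h)) := by
    refine ⟨hhm.indicator hA, fun z => ?_, ⟨M * a, fun z => ?_⟩,
      ⟨ε * a, mul_pos D.kernel.pos ha, fun z hz => ?_⟩⟩
    · exact Set.indicator_nonneg (fun w hw => (mul_pos D.kernel.pos ha).le.trans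
        (hlow (x := w.1) (i := w.2) hw)) z
    · exact Set.indicator_le' (fun w hw => hupp (x := w.1) (i := w.2) hw)
        (fun _ _ => (mul_pos hM ha).le) z
    · rw [Set.indicator_of_mem hz]
      exact hlow hz
  have hae : ((hybridSet (supp q₀)).indicator (Function.uncurry h))⁻¹ =ᵐ[ρ₀]
      Function.uncurry (invMap h) := D.initial.ae_mem_supp.mono fun z hz => by
    rw [uncurry_invMap, Pi.inv_apply, Pi.inv_apply, Set.indicator_of_mem hz]
  -- The image `C g` is bounded away from zero on the supports of `qT`, and `g` agrees with it there
  -- almost everywhere, so `1 / g` is integrable.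
  have hs : IsPositiveOn (hybridSet (supp qT)) (Function.uncurry (sinkhorn P q₀ qT g)) := by
    rw [sinkhorn, D.uncurry_forwardMap ((hh'.integrable_inv D.initial.ae_mem_supp).congr hae),
      ← kernelMap_congr_ae _ hae]
    exact hh'.kernelMap_inv D.kernel.swap D.initial.ae_mem_supp
  have hsg : (Function.uncurry (sinkhorn P q₀ qT g))⁻¹ =ᵐ[ρT] (Function.uncurry g)⁻¹ :=
    (D.terminal.ae_of_ae_restrict hfix).mono fun z hz => congrArg _ hz
  exact ⟨(hs.integrable_inv D.terminal.ae_mem_supp).congr hsg, hgpos.mono fun z hz => hz.le,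
    (hs.integral_inv_pos D.terminal.ae_mem_supp).trans_eq (integral_congr_ae hsg)⟩

/-- Uniqueness of the normalized fixed point. -/
lemma fixedPoint_unique (D : SchrodingerData P ρ₀ ρT q₀ qT ε M)
    (hf : IsAdmissible (supp qT) f) (hffix : sinkhorn P q₀ qT f = f)
    (hfn : suppNorm (supp qT) f = 1) {g : Space d → Fin m → ℝ}
    (hm : ∀ j, Measurable fun y => g y j)
    (hpos : ∀ j, ∀ᵐ y ∂(volume.restrict (supp qT j)), 0 < g y j)
    (hfix : ∀ j, ∀ᵐ y ∂(volume.restrict (supp qT j)), sinkhorn P q₀ qT g y j = g y j)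
    (hgn : suppNorm (supp qT) g = 1) :
    (∀ j, ∀ᵐ y ∂(volume.restrict (supp qT j)), g y j = f y j) ∧
      (sinkhorn P q₀ qT g = g → g = f) := by
  obtain ⟨hi, h0, hI⟩ := D.inv_of_fixedPoint hm hpos hfix
  have hgm := measurable_uncurry_of_forall hm
  have hst := D.uncurry_sinkhorn hm hi h0 hI
  have hsp := D.kernel.isPositiveOn_step D.initial.ae_mem_supp D.terminal.ae_mem_supp hgm hi h0 hI
  have hstep : step (hybridKernel P) ρ₀ ρT (Function.uncurry g) =ᵐ[ρT] Function.uncurry g := by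
    rw [← hst]
    exact D.terminal.ae_of_ae_restrict hfix
  obtain ⟨c, hc, hcf⟩ := eq_smul_of_fixedPoint D.kernel D.initial.ae_mem_supp
    D.terminal.ae_mem_supp (isAdmissible_iff.1 hf) hsp
    (by rw [← D.uncurry_sinkhorn_of_isAdmissible hf, hffix]) (step_congr_ae _ _ hstep)
  have hsf : sinkhorn P q₀ qT g = c • f := congrArg Function.curry (hst.trans hcf)
  have hc1 : c = 1 := by
    have := suppNorm_congr_ae hfix
    rw [hsf, suppNorm_const_smul hc, hfn, hgn, mul_one] at this
    exact ENNReal.ofReal_eq_one.1 this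
  rw [hc1, one_smul] at hsf
  rw [hsf]
  exact ⟨fun j => by
    filter_upwards [hfix j] with y hy
    rw [← hy, hsf], fun h => h.symm⟩

/-- The normalized iterates approach the normalized fixed point uniformly on the logarithmic
scale. -/
lemma exists_normalize_bounds (D : SchrodingerData P ρ₀ ρT q₀ qT ε M)
    (hf : IsAdmissible (supp qT) f) (hffix : sinkhorn P q₀ qT f = f)
    (hfn : suppNorm (supp qT) f = 1) {f₀ : Space d → Fin m → ℝ}
    (hf₀ : IsAdmissible (supp qT) f₀) :
    ∃ η : ℕ → ℝ, Tendsto η atTop (𝓝 0) ∧ ∀ k j, ∀ y ∈ supp qT j,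
      Real.exp (-η k) * f y j ≤ normalize (supp qT) ((sinkhorn P q₀ qT)^[k] f₀) y j ∧
      normalize (supp qT) ((sinkhorn P q₀ qT)^[k] f₀) y j ≤ Real.exp (η k) * f y j := by
  have hfp := isAdmissible_iff.1 hf
  obtain ⟨F, hF, hFfix, η, hη, hlog⟩ := exists_fixedPoint_of_iterate D.kernel
    (measurableSet_hybridSet (measurableSet_supp qT)) D.initial.ae_mem_supp
    D.terminal.ae_mem_supp (isAdmissible_iff.1 hf₀)
  obtain ⟨c, hc, rfl⟩ := eq_smul_of_fixedPoint D.kernel D.initial.ae_mem_supp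
    D.terminal.ae_mem_supp hfp hF (by rw [← D.uncurry_sinkhorn_of_isAdmissible hf, hffix]) hFfix
  -- The error doubles: the iterate is within a factor `exp (η k)` of `c • f`, and so is its norm of
  -- `c`.
  refine ⟨fun k => η k + η k, by simpa using hη.add hη, fun k => ?_⟩
  obtain ⟨hadm, hunc⟩ := D.isAdmissible_iterate_sinkhorn hf₀ k
  set g := (sinkhorn P q₀ qT)^[k] f₀
  have hgp := isAdmissible_iff.1 hadm
  have hbd (j : Fin m) (y : Space d) (hy : y ∈ supp qT j) :
      Real.exp (-η k) * c * f y j ≤ g y j ∧ g y j ≤ Real.exp (η k) * c * f y j := by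
    have h := abs_le.1 (hlog k (y, j) hy)
    have hgy : 0 < g y j := hgp.pos (y := (y, j)) hy
    have hfy : 0 < f y j := hfp.pos (y := (y, j)) hy
    have hcf : 0 < c * f y j := mul_pos hc hfy
    rw [← hunc] at h
    simp only [Function.uncurry, Pi.smul_apply, smul_eq_mul] at h
    constructor
    · rw [mul_assoc, ← Real.log_le_log_iff (by positivity) hgy,
        Real.log_mul (Real.exp_pos _).ne' hcf.ne', Real.log_exp]
      linarith [h.1]
    · rw [mul_assoc, ← Real.log_le_log_iff hgy (by positivity),
        Real.log_mul (Real.exp_pos _).ne' hcf.ne', Real.log_exp]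
      linarith [h.2]
  have hne := D.suppNorm_ne_zero hadm
  have htop := hadm.suppNorm_ne_top D.compact
  have hae {s : Space d → Fin m → Prop} (hs : ∀ j, ∀ y ∈ supp qT j, s y j) (j : Fin m) :
      ∀ᵐ y ∂(volume.restrict (supp qT j)), s y j :=
    (ae_restrict_iff' (measurableSet_supp qT j)).2 (Eventually.of_forall (hs j))
  have hn1 : (suppNorm (supp qT) g).toReal ≤ Real.exp (η k) * c := by
    refine ENNReal.toReal_le_of_le_ofReal (by positivity) ?_
    rw [← mul_one (ENNReal.ofReal _), ← hfn]
    refine suppNorm_le_mul (hae fun j y hy => ?_)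
    rw [abs_of_nonneg (hadm.nonneg y j), abs_of_nonneg (hf.nonneg y j)]
    exact (hbd j y hy).2
  have hn2 : Real.exp (-η k) * c ≤ (suppNorm (supp qT) g).toReal := by
    rw [← ENNReal.ofReal_le_iff_le_toReal htop, ← mul_one (ENNReal.ofReal _), ← hfn,
      ← suppNorm_const_smul (by positivity), ← one_mul (suppNorm (supp qT) g),
      ← ENNReal.ofReal_one]
    refine suppNorm_le_mul (hae fun j y hy => ?_)
    rw [one_mul, abs_of_nonneg (hadm.nonneg y j), Pi.smul_apply, Pi.smul_apply,
      smul_eq_mul, abs_of_nonneg (mul_nonneg (by positivity) (hf.nonneg y j))]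
    exact (hbd j y hy).1
  intro j y hy
  have hn : 0 < (suppNorm (supp qT) g).toReal := ENNReal.toReal_pos hne htop
  set n := (suppNorm (supp qT) g).toReal
  have hfy := hf.nonneg y j
  have hexp : Real.exp (-η k) * Real.exp (η k) = 1 := by rw [← Real.exp_add]; simp
  simp only [normalize]
  rw [neg_add, Real.exp_add, Real.exp_add, le_div_iff₀ hn, div_le_iff₀ hn]
  constructor
  · calc Real.exp (-η k) * Real.exp (-η k) * f y j * n
        ≤ Real.exp (-η k) * Real.exp (-η k) * f y j * (Real.exp (η k) * c) := by gcongr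
      _ = (Real.exp (-η k) * Real.exp (η k)) * (Real.exp (-η k) * c * f y j) := by ring
      _ ≤ g y j := by rw [hexp, one_mul]; exact (hbd j y hy).1
  · calc g y j ≤ (Real.exp (-η k) * Real.exp (η k)) * (Real.exp (η k) * c * f y j) := by
          rw [hexp, one_mul]; exact (hbd j y hy).2
      _ = Real.exp (η k) * Real.exp (η k) * f y j * (Real.exp (-η k) * c) := by ring
      _ ≤ Real.exp (η k) * Real.exp (η k) * f y j * n := by gcongr

/-- Convergence of the normalized iterates in the norm and in Hilbert's projective metric. -/
lemma tendsto_normalize (D : SchrodingerData P ρ₀ ρT q₀ qT ε M)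
    (hf : IsAdmissible (supp qT) f) (hffix : sinkhorn P q₀ qT f = f)
    (hfn : suppNorm (supp qT) f = 1) {f₀ : Space d → Fin m → ℝ}
    (hf₀ : IsAdmissible (supp qT) f₀) :
    Tendsto (fun k : ℕ => suppNorm (supp qT)
      (normalize (supp qT) ((sinkhorn P q₀ qT)^[k] f₀) - f)) atTop (𝓝 0) ∧
    Tendsto (fun k : ℕ => hilbertMetric (supp qT)
      (normalize (supp qT) ((sinkhorn P q₀ qT)^[k] f₀)) f) atTop (𝓝 0) := by
  obtain ⟨η, hη, hbd⟩ := D.exists_normalize_bounds hf hffix hfn hf₀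
  constructor
  · have hlim : Tendsto (fun k => ENNReal.ofReal (Real.exp (η k) - 1)) atTop (𝓝 0) := by
      simpa using ENNReal.tendsto_ofReal
        (((Real.continuous_exp.tendsto 0).comp hη).sub_const 1)
    refine tendsto_of_tendsto_of_tendsto_of_le_of_le tendsto_const_nhds hlim
      (fun _ => zero_le) fun k => ?_
    rw [← mul_one (ENNReal.ofReal _), ← hfn]
    refine suppNorm_le_mul fun j => (ae_restrict_iff' (measurableSet_supp qT j)).2
      (Eventually.of_forall fun y hy => ?_)
    obtain ⟨h1, h2⟩ := hbd k j y hy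
    have hfy := hf.nonneg y j
    -- This gives `1 - exp (-η) ≤ exp η - 1`, so one constant bounds both sides of the difference.
    have hexp : 2 ≤ Real.exp (η k) + Real.exp (-η k) := by
      have := Real.add_one_le_exp (η k)
      have := Real.add_one_le_exp (-η k)
      linarith
    rw [abs_of_nonneg hfy, abs_le, Pi.sub_apply, Pi.sub_apply]
    constructor <;> nlinarith
  · obtain ⟨z, hz⟩ := D.terminal.ae_mem_supp.exists
    have : Nonempty {z : State d m // z.1 ∈ supp qT z.2} := ⟨⟨z, hz⟩⟩
    refine tendsto_iSup_div_iInf hη fun k z => ?_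
    have hfz : 0 < f z.1.1 z.1.2 := (isAdmissible_iff.1 hf).pos z.2
    obtain ⟨h1, h2⟩ := hbd k z.1.2 z.1.1 z.2
    exact ⟨(le_div_iff₀ hfz).2 h1, (div_le_iff₀ hfz).2 h2⟩

omit [IsProbabilityMeasure ρ₀] in
lemma uncurry_backwardMap_invMap (D : SchrodingerData P ρ₀ ρT q₀ qT ε M)
    (hf : IsAdmissible (supp qT) f) : Function.uncurry (backwardMap P qT (invMap f))
      = kernelMap (hybridKernel P) ρT (Function.uncurry f)⁻¹ := by
  have h := (isAdmissible_iff.1 hf).integrable_inv (ν := ρT) D.terminal.ae_mem_supp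
  rw [D.uncurry_backwardMap (by rwa [uncurry_invMap]), uncurry_invMap]

/-- The fixed point yields a solution of the Schrödinger system. -/
lemma isSchrodingerSolution (D : SchrodingerData P ρ₀ ρT q₀ qT ε M)
    (hf : IsAdmissible (supp qT) f) (hffix : sinkhorn P q₀ qT f = f) (R₀ : Measure (State d m)) :
    IsSchrodingerSolution R₀ P q₀ qT (backwardMap P qT (invMap f))
      (fun x i => q₀ x i / backwardMap P qT (invMap f) x i) (fun y j => qT y j / f y j) f := by
  have hfp := isAdmissible_iff.1 hf
  have hb := D.uncurry_backwardMap_invMap hf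
  have hφ : IsPositiveOn (hybridSet (supp q₀))
      (Function.uncurry (backwardMap P qT (invMap f))) := by
    rw [hb]
    exact hfp.kernelMap_inv D.kernel D.terminal.ae_mem_supp
  have hφ' := isAdmissible_iff.2 hφ
  set φ := backwardMap P qT (invMap f) with hφdef
  have hiT : Integrable (Function.uncurry f)⁻¹ ρT := hfp.integrable_inv D.terminal.ae_mem_supp
  have hi₀ : Integrable (Function.uncurry φ)⁻¹ ρ₀ := hφ.integrable_inv D.initial.ae_mem_supp
  have hslice {μ : Measure (State d m)} {q : Space d → Fin m → ℝ} (hq : HasDensities μ q)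
      {u : State d m → ℝ} (hu : Integrable u μ) (j : Fin m) :
      Integrable fun y => q y j * u (y, j) := by
    rw [hq.eq_densityMeasure, integrable_densityMeasure_iff
      (measurable_uncurry_of_forall hq.measurable) fun z => hq.nonneg _ _] at hu
    exact integrable_hybridVolume_iff.1 hu j
  refine ⟨fun i => ⟨hφ'.measurable i, (D.initial.measurable i).div (hφ'.measurable i),
    (D.terminal.measurable i).div (hf.measurable i), hf.measurable i⟩,
    fun x i => ⟨hφ'.nonneg x i, div_nonneg (D.initial.nonneg x i) (hφ'.nonneg x i),
      div_nonneg (D.terminal.nonneg x i) (hf.nonneg x i), hf.nonneg x i⟩,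
    Eventually.of_forall fun z => ⟨fun j => ?_, ?_⟩,
    fun j => Eventually.of_forall fun y => ⟨fun i => ?_, ?_⟩,
    fun i => Eventually.of_forall fun x => ?_, fun j => Eventually.of_forall fun y => ?_⟩
  · exact (hslice D.terminal (D.kernel.integrable_mul hiT z) j).congr <|
      Eventually.of_forall fun y => by
        simp only [hybridKernel, Pi.inv_apply, Function.uncurry]; ring
  · rw [hφdef, backwardMap]
    refine Finset.sum_congr rfl fun j _ => integral_congr_ae <| Eventually.of_forall fun y => ?_
    simp only [invMap]; ring
  · exact (hslice D.initial (D.kernel.swap.integrable_mul hi₀ (y, j)) i).congr <|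
      Eventually.of_forall fun x => by
        simp only [hybridKernel, flip, Pi.inv_apply, Function.uncurry]; ring
  · conv_lhs => rw [← hffix, sinkhorn, forwardMap]
    refine Finset.sum_congr rfl fun i _ => integral_congr_ae <| Eventually.of_forall fun x => ?_
    simp only [invMap]; ring
  · by_cases hx : x ∈ supp q₀ i
    · exact (mul_div_cancel₀ _ (hφ.pos (y := (x, i)) hx).ne').symm
    · have : q₀ x i = 0 := image_eq_zero_of_notMem_tsupport (f := fun x => q₀ x i) hx
      simp [this]
  · by_cases hy : y ∈ supp qT j
    · exact (div_mul_cancel₀ _ (hfp.pos (y := (y, j)) hy).ne').symm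
    · have : qT y j = 0 := image_eq_zero_of_notMem_tsupport (f := fun y => qT y j) hy
      simp [this]

/-- Uniqueness of the solution of the Schrödinger system up to rescaling. -/
lemma exists_scaling (D : SchrodingerData P ρ₀ ρT q₀ qT ε M)
    (hf : IsAdmissible (supp qT) f) (hffix : sinkhorn P q₀ qT f = f) {R₀ : Measure (State d m)}
    (hac : ρ₀ ≪ R₀) {φ₀ ψ₀ φT ψT : Space d → Fin m → ℝ}
    (h : IsSchrodingerSolution R₀ P q₀ qT φ₀ ψ₀ φT ψT) :
    ∃ c : ℝ, 0 < c ∧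
      (∀ᵐ z ∂ρ₀, φ₀ z.1 z.2 = c⁻¹ * backwardMap P qT (invMap f) z.1 z.2 ∧
        ψ₀ z.1 z.2 = c * (q₀ z.1 z.2 / backwardMap P qT (invMap f) z.1 z.2)) ∧
      (∀ᵐ z ∂ρT, φT z.1 z.2 = c⁻¹ * (qT z.1 z.2 / f z.1 z.2) ∧ ψT z.1 z.2 = c * f z.1 z.2) ∧
      ((∀ i, ∀ᵐ x, x ∉ supp q₀ i → ψ₀ x i = 0) →
        (∀ j, ∀ᵐ y, y ∉ supp qT j → φT y j = 0) →
        (∀ᵐ z ∂(R₀), φ₀ z.1 z.2 = c⁻¹ * backwardMap P qT (invMap f) z.1 z.2) ∧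
        (∀ i, ∀ᵐ x, ψ₀ x i = c * (q₀ x i / backwardMap P qT (invMap f) x i)) ∧
        (∀ j, ∀ᵐ y, φT y j = c⁻¹ * (qT y j / f y j) ∧ ψT y j = c * f y j)) := by
  have hfp := isAdmissible_iff.1 hf
  have hb := D.uncurry_backwardMap_invMap hf
  have hback : ∀ᵐ z ∂(R₀), Integrable (fun w => hybridKernel P z w * Function.uncurry φT w)
      (hybridVolume d m) ∧ Function.uncurry φ₀ z
        = ∫ w, hybridKernel P z w * Function.uncurry φT w ∂(hybridVolume d m) :=
    h.backward.mono fun z hz => by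
      have hint := integrable_hybridVolume_iff (g := fun w =>
        hybridKernel P z w * Function.uncurry φT w).2 hz.1
      exact ⟨hint, hz.2.trans (integral_hybridVolume hint).symm⟩
  have hfac : IsFactorization (hybridKernel P) (hybridVolume d m) (hybridVolume d m)
      (Function.uncurry q₀) (Function.uncurry qT) (Function.uncurry φ₀) (Function.uncurry ψ₀)
      (Function.uncurry φT) (Function.uncurry ψT) :=
    { measurable_phi₀ := measurable_uncurry_of_forall fun i => (h.measurable i).1
      measurable_psi₀ := measurable_uncurry_of_forall fun i => (h.measurable i).2.1
      measurable_phiT := measurable_uncurry_of_forall fun i => (h.measurable i).2.2.1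
      measurable_psiT := measurable_uncurry_of_forall fun i => (h.measurable i).2.2.2
      phi₀_nonneg := fun z => (h.nonneg z.1 z.2).1
      psi₀_nonneg := fun z => (h.nonneg z.1 z.2).2.1
      phiT_nonneg := fun z => (h.nonneg z.1 z.2).2.2.1
      psiT_nonneg := fun z => (h.nonneg z.1 z.2).2.2.2
      -- Absolute continuity passes the equation from `R₀` to `ρ₀`, that is, to the points where `q₀
      -- ≠ 0`.
      backward := D.initial.ae_iff.1 (hac.ae_le hback)
      forward := ae_hybridVolume_iff.2 fun j => (h.forward j).mono fun y hy => by
        have hint := integrable_hybridVolume_iff (g := fun z =>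
          hybridKernel P z (y, j) * Function.uncurry ψ₀ z).2 hy.1
        exact ⟨hint, hy.2.trans (integral_hybridVolume hint).symm⟩
      initial := ae_hybridVolume_iff.2 h.initial
      terminal := ae_hybridVolume_iff.2 h.terminal }
  have e₀ := D.initial.eq_densityMeasure
  have eT := D.terminal.eq_densityMeasure
  have : IsProbabilityMeasure (densityMeasure (hybridVolume d m) (Function.uncurry q₀)) := by
    rw [← e₀]; infer_instance
  have : IsProbabilityMeasure (densityMeasure (hybridVolume d m) (Function.uncurry qT)) := by
    rw [← eT]; infer_instance
  have hfix : step (hybridKernel P) (densityMeasure (hybridVolume d m) (Function.uncurry q₀))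
      (densityMeasure (hybridVolume d m) (Function.uncurry qT)) (Function.uncurry f)
        = Function.uncurry f := by
    rw [← e₀, ← eT, ← D.uncurry_sinkhorn_of_isAdmissible hf, hffix]
  have hq₀m := measurable_uncurry_of_forall D.initial.measurable
  have hqTm := measurable_uncurry_of_forall D.terminal.measurable
  have hq₀0 : ∀ z, 0 ≤ Function.uncurry q₀ z := fun z => D.initial.nonneg _ _
  have hqT0 : ∀ z, 0 ≤ Function.uncurry qT z := fun z => D.terminal.nonneg _ _
  have hA := D.initial.ae_mem_supp
  have hB := D.terminal.ae_mem_supp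
  rw [e₀] at hA
  rw [eT] at hB
  obtain ⟨c, hc, h1, h2⟩ := hfac.exists_scaling D.kernel hq₀m hq₀0 hqTm hqT0 hA hB hfp hfix
  refine ⟨c, hc, ?_, ?_, fun hoff₀ hoffT => ?_⟩
  · rw [D.initial.ae_iff]
    filter_upwards [h1, hfac.initial] with z hz hi hq
    have hz := hz hq
    rw [← eT, ← hb] at hz
    refine ⟨hz, ?_⟩
    have hne : Function.uncurry φ₀ z ≠ 0 := fun h0 => hq (by rw [hi, h0, zero_mul])
    rw [hz] at hi hne
    have h3 := right_ne_zero_of_mul hne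
    simp only [Function.uncurry] at hi h3
    rw [hi]; field_simp
  · rw [D.terminal.ae_iff]
    filter_upwards [h2, hfac.terminal] with z hz ht hq
    have hz := hz hq
    refine ⟨?_, hz⟩
    have hne : Function.uncurry ψT z ≠ 0 := fun h0 => hq (by rw [ht, h0, mul_zero])
    rw [hz] at ht hne
    have h3 := right_ne_zero_of_mul hne
    simp only [Function.uncurry] at ht h3
    rw [ht]; field_simp
  · obtain ⟨k1, k2, k3, k4⟩ := hfac.eq_of_vanish D.kernel hq₀m hq₀0 hqTm hqT0 hA hB hfix h1 h2
      (ae_hybridVolume_iff.2 hoff₀) (ae_hybridVolume_iff.2 hoffT)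
    rw [← eT, ← hb] at k1 k4
    -- The backward equation is needed here under `R₀` itself: wherever it holds, it determines `φ₀`
    -- from `φT`, now known almost everywhere.
    refine ⟨hback.mono fun z hz => k4 z hz.2, ae_hybridVolume_iff.1 k1, fun j => ?_⟩
    filter_upwards [ae_hybridVolume_iff.1 k2 j, ae_hybridVolume_iff.1 k3 j] with y h3 h4
    exact ⟨h3, h4⟩

omit [NeZero m] [IsProbabilityMeasure ρ₀] [IsProbabilityMeasure ρT] in
/-- The bounds for a kernel that is bounded, and continuous and positive on the compact product
of the supports. -/
lemma exists_of_continuousOn (hP : ∀ i j, Measurable fun z : Space d × Space d => P i j z.1 z.2)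
    (hP0 : ∀ i j x y, 0 ≤ P i j x y) (hPb : ∀ i j, ∃ M : ℝ, ∀ x y, P i j x y ≤ M)
    (hq₀ : HasDensities ρ₀ q₀) (hqT : HasDensities ρT qT)
    (hcpt₀ : ∀ i, IsCompact (supp q₀ i)) (hcptT : ∀ j, IsCompact (supp qT j))
    (hcont : ∀ i j, ContinuousOn (fun z : Space d × Space d => P i j z.1 z.2)
      (supp q₀ i ×ˢ supp qT j))
    (hpos : ∀ i j, ∀ x ∈ supp q₀ i, ∀ y ∈ supp qT j, 0 < P i j x y) :
    ∃ ε M : ℝ, SchrodingerData P ρ₀ ρT q₀ qT ε M := by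
  choose C hC using hPb
  have hlow (i j : Fin m) : ∃ e : ℝ, 0 < e ∧ ∀ z ∈ supp q₀ i ×ˢ supp qT j, e ≤ P i j z.1 z.2 :=
    ((hcpt₀ i).prod (hcptT j)).exists_forall_le' (hcont i j) fun z hz =>
      hpos i j z.1 hz.1 z.2 hz.2
  choose e he hle using hlow
  obtain ⟨ε, hε, hεe⟩ : ∃ ε : ℝ, 0 < ε ∧ ∀ i j, ε ≤ e i j := by
    rcases isEmpty_or_nonempty (Fin m) with hm | hm
    · exact ⟨1, one_pos, fun i => hm.elim i⟩
    · obtain ⟨z, hz⟩ := Finite.exists_min fun z : Fin m × Fin m => e z.1 z.2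
      exact ⟨e z.1 z.2, he _ _, fun i j => hz (i, j)⟩
  obtain ⟨M, hM⟩ : ∃ M : ℝ, ∀ i j, C i j ≤ M := by
    obtain ⟨M, hM⟩ := (Set.finite_range fun z : Fin m × Fin m => C z.1 z.2).bddAbove
    exact ⟨M, fun i j => hM ⟨(i, j), rfl⟩⟩
  -- The maximum secures `ε ≤ M` even when a support is empty.
  refine ⟨ε, max ε M, ⟨?_, hε, le_max_left _ _, fun z w => hP0 _ _ _ _, fun z w =>
    ((hC _ _ _ _).trans (hM _ _)).trans (le_max_right _ _), fun z hz w hw =>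
      (hεe _ _).trans (hle z.2 w.2 (z.1, w.1) ⟨hz, hw⟩)⟩, hq₀, hqT, hcptT⟩
  have h1 : Measurable fun v : (Space d × Space d) × (Fin m × Fin m) =>
      P v.2.1 v.2.2 v.1.1 v.1.2 := measurable_from_prod_countable_left fun v => hP v.1 v.2
  exact h1.comp (f := fun u : State d m × State d m => ((u.1.1, u.2.1), (u.1.2, u.2.2)))
    (by fun_prop)

end SchrodingerData

end RegimeSchrodinger

end

/-! ### The theorem for the transition density between the two endpoint times. -/

open RegimeSchrodinger in
theorem mainTheorem6 (d m : ℕ) [NeZero m] (T : ℝ) (hT : 0 < T)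
    -- the reference path measure and its transition density
    (R : Measure (CadlagPath d m T)) [IsProbabilityMeasure R]
    (p : Fin m → Fin m → Set.Icc (0 : ℝ) T → Space d → Set.Icc (0 : ℝ) T → Space d → ℝ)
    (hp : IsTransitionDensity R p)
    -- the endpoints of the time interval, the initial data, and the kernel between the endpoints
    (t₀ tT : Set.Icc (0 : ℝ) T) (ht₀ : (t₀ : ℝ) = 0) (htT : (tT : ℝ) = T)
    (R₀ : Measure (State d m)) (hR₀ : R₀ = marginal R t₀)
    (hR₀_density : ∃ r₀, HasDensities R₀ r₀)
    (P : Fin m → Fin m → Space d → Space d → ℝ) (hP : P = fun i j x y => p i j t₀ x tT y)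
    -- the target distributions
    (ρ₀ ρT : Measure (State d m)) [IsProbabilityMeasure ρ₀] [IsProbabilityMeasure ρT]
    (hρ₀R₀ : ρ₀ ≪ R₀)
    (q₀ qT : Space d → Fin m → ℝ) (hq₀ : HasDensities ρ₀ q₀) (hqT : HasDensities ρT qT)
    (hcpt₀ : ∀ i, IsCompact (supp q₀ i)) (hcptT : ∀ j, IsCompact (supp qT j))
    (hcont : ∀ i j, ContinuousOn (fun z : Space d × Space d => P i j z.1 z.2)
      (supp q₀ i ×ˢ supp qT j))
    (hpos : ∀ i j, ∀ x ∈ supp q₀ i, ∀ y ∈ supp qT j, 0 < P i j x y) :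
    ∃ f : Space d → Fin m → ℝ,
      -- `f` is a normalized fixed point
      (IsAdmissible (supp qT) f ∧ sinkhorn P q₀ qT f = f ∧ suppNorm (supp qT) f = 1) ∧
      -- it is the only one, almost everywhere on the supports and, if the fixed point equation
      -- holds everywhere, everywhere
      (∀ g : Space d → Fin m → ℝ, (∀ j, Measurable fun y => g y j) →
        (∀ j, ∀ᵐ y ∂(volume.restrict (supp qT j)), 0 < g y j) →
        (∀ j, ∀ᵐ y ∂(volume.restrict (supp qT j)), sinkhorn P q₀ qT g y j = g y j) →
        suppNorm (supp qT) g = 1 →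
        (∀ j, ∀ᵐ y ∂(volume.restrict (supp qT j)), g y j = f y j) ∧
        (sinkhorn P q₀ qT g = g → g = f)) ∧
      -- the normalized iterates are well defined and converge to it
      (∀ f₀ : Space d → Fin m → ℝ, IsAdmissible (supp qT) f₀ →
        (∀ k : ℕ, IsAdmissible (supp qT) ((sinkhorn P q₀ qT)^[k] f₀) ∧
          suppNorm (supp qT) ((sinkhorn P q₀ qT)^[k] f₀) ≠ 0 ∧
          suppNorm (supp qT) ((sinkhorn P q₀ qT)^[k] f₀) ≠ ∞) ∧
        Tendsto (fun k : ℕ => suppNorm (supp qT)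
          (normalize (supp qT) ((sinkhorn P q₀ qT)^[k] f₀) - f)) atTop (𝓝 0) ∧
        Tendsto (fun k : ℕ => hilbertMetric (supp qT)
          (normalize (supp qT) ((sinkhorn P q₀ qT)^[k] f₀)) f) atTop (𝓝 0)) ∧
      -- it yields a solution of the Schrödinger system
      (let φ₀ : Space d → Fin m → ℝ := backwardMap P qT (invMap f)
       let ψ₀ : Space d → Fin m → ℝ := fun x i => q₀ x i / φ₀ x i
       let φT : Space d → Fin m → ℝ := fun y j => qT y j / f y j
       IsSchrodingerSolution R₀ P q₀ qT φ₀ ψ₀ φT f ∧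
       -- which is unique up to rescaling
       ∀ φ₀' ψ₀' φT' ψT' : Space d → Fin m → ℝ,
        IsSchrodingerSolution R₀ P q₀ qT φ₀' ψ₀' φT' ψT' →
        ∃ c : ℝ, 0 < c ∧
          (∀ᵐ z ∂ρ₀, φ₀' z.1 z.2 = c⁻¹ * φ₀ z.1 z.2 ∧ ψ₀' z.1 z.2 = c * ψ₀ z.1 z.2) ∧
          (∀ᵐ z ∂ρT, φT' z.1 z.2 = c⁻¹ * φT z.1 z.2 ∧ ψT' z.1 z.2 = c * f z.1 z.2) ∧
          ((∀ i, ∀ᵐ x, x ∉ supp q₀ i → ψ₀' x i = 0) →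
            (∀ j, ∀ᵐ y, y ∉ supp qT j → φT' y j = 0) →
            (∀ᵐ z ∂(R₀), φ₀' z.1 z.2 = c⁻¹ * φ₀ z.1 z.2) ∧
            (∀ i, ∀ᵐ x, ψ₀' x i = c * ψ₀ x i) ∧
            (∀ j, ∀ᵐ y, φT' y j = c⁻¹ * φT y j ∧ ψT' y j = c * f y j))) := by
  have ht : t₀ < tT := Subtype.coe_lt_coe.1 (by rw [ht₀, htT]; exact hT)
  obtain ⟨ε, M, D⟩ := SchrodingerData.exists_of_continuousOn (P := P)
    (fun i j => by rw [hP]; exact hp.measurable i j t₀ tT ht)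
    (fun i j x y => by rw [hP]; exact hp.nonneg i j t₀ tT x y ht)
    (fun i j => by rw [hP]; exact hp.bounded i j t₀ tT ht) hq₀ hqT hcpt₀ hcptT hcont hpos
  obtain ⟨f, hf, hfix, hfn⟩ := D.exists_fixedPoint
  refine ⟨f, ⟨hf, hfix, hfn⟩, fun g hm hg hgfix hgn => D.fixedPoint_unique hf hfix hfn hm hg hgfix
    hgn, fun f₀ hf₀ => ⟨fun k => ?_, D.tendsto_normalize hf hfix hfn hf₀⟩,
    D.isSchrodingerSolution hf hfix R₀, fun φ₀' ψ₀' φT' ψT' h => ?_⟩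
  · have hk := (D.isAdmissible_iterate_sinkhorn hf₀ k).1
    exact ⟨hk, D.suppNorm_ne_zero hk, hk.suppNorm_ne_top D.compact⟩
  · exact D.exists_scaling hf hfix hρ₀R₀ h
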